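/- **Setting.** Let $\lambda\in C^1([0,\infty);(0,\infty))$ be non-increasing, with $|\lambda'(s)|\le K$ for all $s\ge 0$ for some constant $K>0$, and let $\rho_s>0$, $\sigma>0$. A left-continuous function $f$ on $[0,1]$ is called $PC^1$ if for every $x\in[0,1)$ the limits $\lim_{y\to x^+}f(y)$ and $\lim_{h\to0^+,\,y\to x^+}h^{-1}(f(y+h)-f(y))$ exist and are finite, $f$ has a finite left derivative at every $x\in(0,1]$, and off a finite subset of $(0,1)$ it is differentiable on $(0,1)$ with continuous derivative. *Plant.* For an influx $u>0$ and an initial profile $\rho_0\in PC^1([0,1])$ with $\inf_{(0,1]}\rho_0>0$, consider $$\partial_t\rho(t,x)+\lambda(W(t))\,\partial_x\rho(t,x)=0,\quad W(t)=\int_0^1\rho(t,x)\,dx,\quad \rho(t,0)\lambda(W(t))=u,\quad \rho(0,x)=\rho_0(x)\ (0<x\le1).$$ A solution has $W$ continuous, $\rho[t]:=\rho(t,\cdot)\in PC^1([0,1])$ and $\inf_{[0,1]}\rho[t]>0$ for every $t$, and is of class $C^1$ and satisfies the PDE off the curves $x=r_j(t)$ (where $r_j(t)\le1$) and $x=r_j(t)-1$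 (where $1\le r_j(t)\le 2$), with $r_j(t)=\xi_j+\int_0^t\lambda(W(s))\,ds$, where $\xi_0=0$ and $\xi_1,\dots,\xi_N\in[0,1]$ are points off which (together with $\xi_0$) $\rho_0$ is $C^1$. The other equations hold for all $t$. *Closed loop.* Put $t_0=0$. Given $t_i$ and $\rho[t_i]$, let $u_i=\rho_s\lambda(W(t_i))$, let $y(\tau,x)$, $\tau\ge t_i$, be the solution of the plant started at time $t_i$ from $\rho[t_i]$ with constant influx $u_i$, let $W_y(\tau)=\int_0^1y(\tau,x)\,dx$, and let $$\mu_i=\inf\Big\{\tau>t_i:\ \Big|\ln\tfrac{y(\tau,0)}{\rho_s}\Big|>\exp\Big(-\sigma\int_{t_i}^{\tau}\lambda(W_y(s))\,ds\Big)\sup_{0<x\le1}\Big(\Big|\ln\tfrac{\rho(t_i,x)}{\rho_s}\Big|e^{-\sigma x}\Big)\Big\},\qquad t_{i+1}=\min\Big(t_i+\tfrac1{\lambda(0)},\,\mu_i\Big)$$ ($\inf\emptyset=+\infty$). Set $\rho(t,x)=y(t,x)$ for $t\in[t_i,t_{i+1})$, $x\in[0,1]$, and for $t=t_{i+1}$,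 $x\in(0,1]$, and repeat. **Theorem 2.** There is a non-increasing function $T:[0,\infty)\to(0,\infty)$, depending only on $\lambda,K,\rho_s,\sigma$, such that for every $\rho_0\in PC^1([0,1])$ with $\inf_{(0,1]}\rho_0>0$ the closed loop with $\rho(0,x)=\rho_0(x)$, $0<x\le 1$, has a unique solution, $t_i\to+\infty$, so that the solution is defined for all $t\ge0$, with $\rho[t]\in PC^1([0,1])$ and $\inf_{[0,1]}\rho[t]>0$, and $$\sup_{0\le x\le1}\Big|\ln\tfrac{\rho(t,x)}{\rho_s}\Big|\le \exp\big(-\sigma(c(\rho_0)t-1)\big)\sup_{0<x\le1}\Big|\ln\tfrac{\rho_0(x)}{\rho_s}\Big|\qquad\text{for all }t\ge0,$$ $$t_{i+1}\ge t_i+T\Big(\sup_{0<x\le1}\Big|\ln\tfrac{\rho_0(x)}{\rho_s}\Big|\Big)\qquad\text{for all }i\ge0,$$ where $$c(\rho_0)=\lambda\Big(\rho_s\exp\Big(e^{\sigma}\sup_{0<x\le1}\Big|\ln\tfrac{\rho_0(x)}{\rho_s}\Big|\Big)\Big).$$ -/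

import Mathlib

open Set Filter Topology

namespace Reentrant

/-- `f` (only its values on `[0,1]` matter) is piecewise `C¹` on `[0,1]`: left-continuous on
`(0,1]`, with finite right limits and right difference-quotient limits on `[0,1)` (the latter with
a moving base point `y → x⁺`), left derivatives on `(0,1]`, and differentiable with continuous
derivative on `(0,1)` off a finite set. -/
structure IsPC1 (f : ℝ → ℝ) : Prop where
  left_cont : ∀ x ∈ Ioc (0 : ℝ) 1, Tendsto f (𝓝[<] x) (𝓝 (f x))
  right_lim : ∀ x ∈ Ico (0 : ℝ) 1, ∃ l : ℝ, Tendsto f (𝓝[>] x) (𝓝 l)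
  right_deriv : ∀ x ∈ Ico (0 : ℝ) 1, ∃ l : ℝ,
    Tendsto (fun p : ℝ × ℝ => (f (p.1 + p.2) - f p.1) / p.2) (𝓝[>] x ×ˢ 𝓝[>] (0 : ℝ)) (𝓝 l)
  left_deriv : ∀ x ∈ Ioc (0 : ℝ) 1, ∃ l : ℝ,
    Tendsto (fun h : ℝ => (f (x + h) - f x) / h) (𝓝[<] (0 : ℝ)) (𝓝 l)
  smooth_off : ∃ J : Finset ℝ, (J : Set ℝ) ⊆ Ioo 0 1 ∧
    (∀ x ∈ Ioo (0 : ℝ) 1 \ (J : Set ℝ), DifferentiableAt ℝ f x) ∧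
    ContinuousOn (deriv f) (Ioo (0 : ℝ) 1 \ (J : Set ℝ))

/-- `f` is bounded below by a positive constant on `S`, i.e. `inf_S f > 0`. -/
def HasPosInf (f : ℝ → ℝ) (S : Set ℝ) : Prop := ∃ m : ℝ, 0 < m ∧ ∀ x ∈ S, m ≤ f x

/-- The total work load `W(t) = ∫₀¹ ρ(t,x) dx`. -/
noncomputable def workload (ρ : ℝ → ℝ → ℝ) (t : ℝ) : ℝ := ∫ x in (0 : ℝ)..1, ρ t x

/-- The distance `∫₀ᵗ λ(W(s)) ds` travelled by the characteristics up to time `t`. -/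
noncomputable def travel (lam : ℝ → ℝ) (ρ : ℝ → ℝ → ℝ) (t : ℝ) : ℝ :=
  ∫ s in (0 : ℝ)..t, lam (workload ρ s)

/-- `sup_{x ∈ S} |ln (f(x)/ρs)|`. -/
noncomputable def logSup (ρs : ℝ) (S : Set ℝ) (f : ℝ → ℝ) : ℝ :=
  sSup ((fun x => |Real.log (f x / ρs)|) '' S)

/-- `f ∈ C¹([0,1] \ Ξ)`: `f` is continuous there, and its derivative on `(0,1) \ Ξ` has a
continuous extension to `[0,1] \ Ξ`. -/
def IsC1Off (f : ℝ → ℝ) (Ξ : Finset ℝ) : Prop :=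
  ContinuousOn f (Icc (0 : ℝ) 1 \ (Ξ : Set ℝ)) ∧
  ∃ g : ℝ → ℝ, ContinuousOn g (Icc (0 : ℝ) 1 \ (Ξ : Set ℝ)) ∧
    ∀ x ∈ Ioo (0 : ℝ) 1 \ (Ξ : Set ℝ), HasDerivAt f (g x) x

/-- The curves on which a solution may fail to be `C¹`. With `r_ξ(t) = ξ + ∫₀ᵗ λ(W(s)) ds` these
are `x = r_ξ(t)` (where `r_ξ(t) ≤ 1`) and `x = r_ξ(t) - 1` (where `1 ≤ r_ξ(t) ≤ 2`), `ξ ∈ Ξ`. -/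
def singularSet (lam : ℝ → ℝ) (ρ : ℝ → ℝ → ℝ) (Ξ : Finset ℝ) (h : ℝ) : Set (ℝ × ℝ) :=
  {p | p.1 ∈ Icc 0 h ∧ ∃ ξ ∈ Ξ,
    (ξ + travel lam ρ p.1 ≤ 1 ∧ p.2 = ξ + travel lam ρ p.1) ∨
    (1 ≤ ξ + travel lam ρ p.1 ∧ ξ + travel lam ρ p.1 ≤ 2 ∧ p.2 = ξ + travel lam ρ p.1 - 1)}

/-- On the set `A` of points `(t,x)` the function `ρ` is of class `C¹` (its first derivatives,
taken in the interior of `A`, extend continuously to `A`) and satisfies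
`∂ρ/∂t + λ(W(t)) ∂ρ/∂x = 0`. -/
def SolvesPDEOn (lam : ℝ → ℝ) (ρ : ℝ → ℝ → ℝ) (A : Set (ℝ × ℝ)) : Prop :=
  ContinuousOn (fun p : ℝ × ℝ => ρ p.1 p.2) A ∧
  ∃ ρt ρx : ℝ × ℝ → ℝ, ContinuousOn ρt A ∧ ContinuousOn ρx A ∧
    (∀ p ∈ interior A, HasFDerivAt (fun q : ℝ × ℝ => ρ q.1 q.2)
      (ρt p • ContinuousLinearMap.fst ℝ ℝ ℝ + ρx p • ContinuousLinearMap.snd ℝ ℝ ℝ) p) ∧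
    ∀ p ∈ A, ρt p + lam (workload ρ p.1) * ρx p = 0

/-- `ρ` solves, on the time interval `[0,h]`, the initial-boundary value problem with constant
influx `u` and initial profile `ρ₀`:
`ρ_t + λ(W) ρ_x = 0`, `W(t) = ∫₀¹ ρ(t,x) dx`, `ρ(t,0) λ(W(t)) = u`, `ρ(0,x) = ρ₀(x)` on `(0,1]`.
Here `Ξ` ranges over the finite sets containing `0` off which the initial profile is `C¹`. -/
structure IsIBVPSolution (lam : ℝ → ℝ) (h u : ℝ) (ρ₀ : ℝ → ℝ) (ρ : ℝ → ℝ → ℝ) : Prop where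
  profile : ∀ t ∈ Icc 0 h, IsPC1 (ρ t)
  pos : ∀ t ∈ Icc 0 h, HasPosInf (ρ t) (Icc 0 1)
  workload_cont : ContinuousOn (workload ρ) (Icc 0 h)
  pde : ∀ Ξ : Finset ℝ, 0 ∈ Ξ → (Ξ : Set ℝ) ⊆ Icc 0 1 → IsC1Off ρ₀ Ξ →
    SolvesPDEOn lam ρ ((Icc 0 h ×ˢ Icc 0 1) \ singularSet lam ρ Ξ h)
  boundary : ∀ t ∈ Icc 0 h, ρ t 0 * lam (workload ρ t) = u
  initial : ∀ x ∈ Ioc (0 : ℝ) 1, ρ 0 x = ρ₀ x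

/-- The time `μ` of the first violation of the trigger inequality after the event time `ti`, where
`y` (in the shifted time `τ - ti`) is the solution, with the input frozen at time `ti`, issued from
the profile `ρi = ρ[ti]`. It is `⊤` if there is none. Since the next event occurs at
`min (ti + 1/λ(0)) μ`, only `τ ≤ ti + 1/λ(0)` is relevant. -/
noncomputable def triggerTime (lam : ℝ → ℝ) (ρs σ ti : ℝ) (ρi : ℝ → ℝ) (y : ℝ → ℝ → ℝ) : EReal :=
  sInf ((fun τ : ℝ => (τ : EReal)) '' {τ : ℝ | ti < τ ∧ τ ≤ ti + 1 / lam 0 ∧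
    Real.exp (-σ * travel lam y (τ - ti)) *
        sSup ((fun x => |Real.log (ρi x / ρs)| * Real.exp (-σ * x)) '' Ioc (0 : ℝ) 1)
      < |Real.log (y (τ - ti) 0 / ρs)|})

/-- `(tev, ρ)` is a solution of the event-triggered closed loop with initial profile `ρ₀`:
`tev i` are the event times and `ρ` is the density on `[0, lim tev i) × [0,1]`. At the event time
`tev i` the influx is set to `ρs λ(W(tev i))`; `y` is the resulting solution with frozen influx;
it determines the next event time, up to which `ρ` follows `y`. At the next event time itself the
boundary value at `x = 0` is already the one given by the next influx. Neither the strict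
monotonicity nor the divergence of the event times is required. -/
structure IsClosedLoopSolution (lam : ℝ → ℝ) (ρs σ : ℝ) (ρ₀ : ℝ → ℝ)
    (tev : ℕ → ℝ) (ρ : ℝ → ℝ → ℝ) : Prop where
  start : tev 0 = 0
  initial : ∀ x ∈ Ioc (0 : ℝ) 1, ρ 0 x = ρ₀ x
  step : ∀ i : ℕ, ∃ y : ℝ → ℝ → ℝ,
    IsIBVPSolution lam (1 / lam 0) (ρs * lam (workload ρ (tev i))) (ρ (tev i)) y ∧
    (tev (i + 1) : EReal) =
      min ((tev i + 1 / lam 0 : ℝ) : EReal) (triggerTime lam ρs σ (tev i) (ρ (tev i)) y) ∧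
    (∀ s ∈ Ico 0 (tev (i + 1) - tev i), ∀ x ∈ Icc (0 : ℝ) 1, ρ (tev i + s) x = y s x) ∧
    (∀ x ∈ Ioc (0 : ℝ) 1, ρ (tev (i + 1)) x = y (tev (i + 1) - tev i) x)

/-- The constant `c(ρ₀) = λ(ρs exp(exp(σ) sup_{0<x≤1} |ln(ρ₀(x)/ρs)|))`. -/
noncomputable def decayConst (lam : ℝ → ℝ) (ρs σ : ℝ) (ρ₀ : ℝ → ℝ) : ℝ :=
  lam (ρs * Real.exp (Real.exp σ * logSup ρs (Ioc 0 1) ρ₀))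

end Reentrant

/-!
# Event-triggered stabilisation of a re-entrant manufacturing line

*The plant.* Let `a(t) = ∫₀ᵗ λ(W)` be the distance travelled by the characteristics. Since
`a(t) ≤ λ(0) t`, no particle crosses the system during a time `1/λ(0)`, and with constant influx `u`
the density there is `ρ(t,x) = f(x - a(t))` for `x > a(t)` and `ρ(t, a(t) - a(s)) = u / λ(W(s))`
for `s ≤ t` (`Represents`). Integrating, `W(t) = u t + ∫₀^{1-a(t)} f` (`Represents.workload_eq`),
so that `a` solves the ordinary differential equation `a' = λ(u t + ∫₀^{1-a} f)`, whose right-hand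
side is Lipschitz in `a`. Hence the plant is well posed: a solution of the equation defines a
density `Φ(x - a(t))` with `Φ = charProfile`, for which regularity is checked in the single variable
`x - a(t)` (`exists_isIBVPSolution`); conversely, every solution is constant along the
characteristics off the finitely many singular ones, is determined on these by left-continuity, and
is therefore of this form (`IsIBVPSolution.represents`, `IsIBVPSolution.eqOn`).

*Decay.* Consider `V(f) = sup_{0<x≤1} |ln (f(x)/ρs)| e^{-σx}` (`weightedSup`). The weight decreases
at the rate `σ` along characteristics, and the trigger rule bounds the entering values by
`e^{-σ a(t)} V(f)`; so `V(ρ[t]) ≤ e^{-σ a(t)} V(f)` on each sampling interval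
(`Represents.weighted_le`). In particular `V` never exceeds its initial value, the work load stays
bounded, `λ(W)` is at least the decay constant `c(ρ₀)`, and `V` decays exponentially in time.
Replacing `V` by the unweighted norm costs a factor `e^σ`.

*Time between events.* As `u = ρs λ(W(t_i))`, the trigger compares `|ln λ(W(t_i)) - ln λ(W(t))|`
with a quantity which is at least `e^{-σ} V`, and the mass balance shows that `|W(t) - W(t_i)|` is at
most a constant times `(t - t_i) V` (`abs_load_sub_le`). Both sides scale with `V`, which yields a
waiting time depending only on a bound for `V` (`dwellTime`). Consequently events do not
accumulate, and existence and uniqueness for the closed loop follow by concatenation.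
-/

namespace Reentrant

/-! ### The transport speed -/

/-- The standing assumptions on the transport speed `λ`: it is `C¹`, positive and non-increasing on
`[0,∞)`, with derivative bounded by `K`. -/
structure IsSpeed (lam : ℝ → ℝ) (K : ℝ) : Prop where
  contDiffOn : ContDiffOn ℝ 1 lam (Ici 0)
  pos : ∀ s : ℝ, 0 ≤ s → 0 < lam s
  anti : AntitoneOn lam (Ici 0)
  deriv_le : ∀ s : ℝ, 0 ≤ s → |derivWithin lam (Ici 0) s| ≤ K

namespace IsSpeed

variable {lam : ℝ → ℝ} {K : ℝ}

lemma continuousOn (hl : IsSpeed lam K) : ContinuousOn lam (Ici 0) :=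
  hl.contDiffOn.continuousOn

lemma zero_pos (hl : IsSpeed lam K) : 0 < lam 0 := hl.pos 0 le_rfl

lemma le_zero (hl : IsSpeed lam K) {s : ℝ} (hs : 0 ≤ s) : lam s ≤ lam 0 :=
  hl.anti self_mem_Ici hs hs

lemma nonneg_const (hl : IsSpeed lam K) : 0 ≤ K := (abs_nonneg _).trans (hl.deriv_le 0 le_rfl)

lemma abs_sub_le (hl : IsSpeed lam K) {x y : ℝ} (hx : 0 ≤ x) (hy : 0 ≤ y) :
    |lam x - lam y| ≤ K * |x - y| := by
  have := (convex_Ici (0 : ℝ)).norm_image_sub_le_of_norm_derivWithin_le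
    (f := lam) (C := K) (hl.contDiffOn.differentiableOn one_ne_zero)
    (fun s hs => hl.deriv_le s hs) (x := y) (y := x) hy hx
  simpa using this

lemma hasDerivAt (hl : IsSpeed lam K) {s : ℝ} (hs : 0 < s) :
    HasDerivAt lam (derivWithin lam (Ici 0) s) s :=
  ((hl.contDiffOn.differentiableOn one_ne_zero) s hs.le).hasDerivWithinAt.hasDerivAt
    (Ici_mem_nhds hs)

lemma continuousOn_derivWithin (hl : IsSpeed lam K) :
    ContinuousOn (derivWithin lam (Ici 0)) (Ici 0) :=
  hl.contDiffOn.continuousOn_derivWithin (uniqueDiffOn_Ici 0) le_rfl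

/-- `λ` is only given on `[0,∞)`; continued by the constant `λ(0)` it stays Lipschitz. -/
lemma abs_sub_le_max (hl : IsSpeed lam K) (x y : ℝ) :
    |lam (max 0 x) - lam (max 0 y)| ≤ K * |x - y| :=
  (hl.abs_sub_le (le_max_left _ _) (le_max_left _ _)).trans
    (mul_le_mul_of_nonneg_left (by
      simpa [max_comm] using abs_max_sub_max_le_abs x y 0) hl.nonneg_const)

end IsSpeed

/-! ### Piecewise smooth profiles -/

/-- Regularity of a `PC¹` function to the right of a point, in terms of the germ of its derivative:
`f` and `f'` have finite right limits at `x`. -/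
def RightReg (f : ℝ → ℝ) (x : ℝ) : Prop :=
  (∃ l : ℝ, Tendsto f (𝓝[>] x) (𝓝 l)) ∧ (∃ l : ℝ, Tendsto (deriv f) (𝓝[>] x) (𝓝 l)) ∧
    ∀ᶠ z in 𝓝[>] x, DifferentiableAt ℝ f z

lemma eventually_nhds_of_nhdsGT {p : ℝ → Prop} {x : ℝ} (h : ∀ᶠ z in 𝓝[>] x, p z) :
    ∀ᶠ z in 𝓝[>] x, ∀ᶠ y in 𝓝 z, p y := by
  have := eventually_eventually_nhdsWithin.2 h
  filter_upwards [this, self_mem_nhdsWithin] with z hz hxz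
  rwa [isOpen_Ioi.nhdsWithin_eq hxz] at hz

lemma RightReg.congr {f g : ℝ → ℝ} {x : ℝ} (hf : RightReg f x) (h : g =ᶠ[𝓝[>] x] f) :
    RightReg g x := by
  obtain ⟨⟨l, hl⟩, ⟨l', hl'⟩, hd⟩ := hf
  have h2 := eventually_nhds_of_nhdsGT h
  refine ⟨⟨l, hl.congr' h.symm⟩, ⟨l', hl'.congr' ?_⟩, ?_⟩
  · filter_upwards [h2] with z hz using (EventuallyEq.deriv_eq hz).symm
  · filter_upwards [h2, hd] with z hz hz' using hz'.congr_of_eventuallyEq hz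

lemma RightReg.of_hasDerivAt {f g : ℝ → ℝ} {x l l' : ℝ} (hf : Tendsto f (𝓝[>] x) (𝓝 l))
    (hg : Tendsto g (𝓝[>] x) (𝓝 l')) (h : ∀ᶠ z in 𝓝[>] x, HasDerivAt f (g z) z) :
    RightReg f x :=
  ⟨⟨l, hf⟩, ⟨l', hg.congr' (h.mono fun _ hz => hz.deriv.symm)⟩,
    h.mono fun _ hz => hz.differentiableAt⟩

lemma tendsto_sub_const_nhdsGT (x c : ℝ) : Tendsto (fun y => y - c) (𝓝[>] x) (𝓝[>] (x - c)) :=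
  tendsto_nhdsWithin_iff.2
    ⟨tendsto_nhdsWithin_of_tendsto_nhds
      ((continuous_id.sub continuous_const).tendsto' _ _ (by simp)),
      by filter_upwards [self_mem_nhdsWithin] with y hy; simpa using hy⟩

lemma RightReg.comp_sub_const {f : ℝ → ℝ} {x c : ℝ} (hf : RightReg f (x - c)) :
    RightReg (fun y => f (y - c)) x := by
  obtain ⟨⟨l, hl⟩, ⟨l', hl'⟩, hd⟩ := hf
  have ht := tendsto_sub_const_nhdsGT x c
  refine ⟨⟨l, hl.comp ht⟩, ⟨l', (hl'.comp ht).congr fun z => ?_⟩, ?_⟩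
  · simp [deriv_comp_sub_const]
  · filter_upwards [ht.eventually hd] with z hz
    exact hz.comp z ((differentiableAt_id).sub_const c)

/-- By the mean value theorem, a right limit of `f'` is also the limit of the difference quotients
with moving base point. -/
lemma tendsto_slope_prod_of_tendsto_deriv {f : ℝ → ℝ} {x l : ℝ}
    (hl : Tendsto (deriv f) (𝓝[>] x) (𝓝 l)) (hd : ∀ᶠ z in 𝓝[>] x, DifferentiableAt ℝ f z) :
    Tendsto (fun p : ℝ × ℝ => (f (p.1 + p.2) - f p.1) / p.2) (𝓝[>] x ×ˢ 𝓝[>] (0 : ℝ)) (𝓝 l) := by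
  rw [Metric.tendsto_nhds]
  intro ε hε
  obtain ⟨b, hb, hb'⟩ := mem_nhdsGT_iff_exists_Ioo_subset.1
    (hd.and (Metric.tendsto_nhds.1 hl ε hε))
  have hxb : x < b := hb
  have h1 : ∀ᶠ y in 𝓝[>] x, y ∈ Ioo x ((x + b) / 2) := Ioo_mem_nhdsGT (by linarith)
  have h2 : ∀ᶠ h in 𝓝[>] (0 : ℝ), h ∈ Ioo 0 ((b - x) / 2) := Ioo_mem_nhdsGT (by linarith)
  filter_upwards [h1.prod_mk h2] with p hp
  obtain ⟨⟨hy1, hy2⟩, hh1, hh2⟩ := hp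
  have hin : ∀ z ∈ Icc p.1 (p.1 + p.2), z ∈ Ioo x b := fun z hz =>
    ⟨hy1.trans_le hz.1, by linarith [hz.2]⟩
  obtain ⟨c, hc, hc'⟩ := exists_deriv_eq_slope f (a := p.1) (b := p.1 + p.2) (by linarith)
    (fun z hz => (hb' (hin z hz)).1.continuousAt.continuousWithinAt)
    (fun z hz => (hb' (hin z (Ioo_subset_Icc_self hz))).1.differentiableWithinAt)
  rw [add_sub_cancel_left] at hc'
  rw [← hc']
  exact (hb' (hin c (Ioo_subset_Icc_self hc))).2

/-- Conversely, letting the increment tend to zero first. -/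
lemma tendsto_deriv_of_tendsto_slope_prod {f : ℝ → ℝ} {x l : ℝ}
    (hl : Tendsto (fun p : ℝ × ℝ => (f (p.1 + p.2) - f p.1) / p.2) (𝓝[>] x ×ˢ 𝓝[>] (0 : ℝ)) (𝓝 l))
    (hd : ∀ᶠ z in 𝓝[>] x, DifferentiableAt ℝ f z) :
    Tendsto (deriv f) (𝓝[>] x) (𝓝 l) := by
  rw [Metric.tendsto_nhds]
  intro ε hε
  have h1 := (Metric.tendsto_nhds.1 hl (ε / 2) (by positivity)).curry
  filter_upwards [h1, hd] with y hy hdy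
  have ht : Tendsto (fun h : ℝ => (f (y + h) - f y) / h) (𝓝[>] 0) (𝓝 (deriv f y)) := by
    simpa [div_eq_inv_mul] using hdy.hasDerivAt.tendsto_slope_zero_right
  have := le_of_tendsto (ht.dist tendsto_const_nhds) (hy.mono fun _ h => le_of_lt h)
  linarith

lemma hasDerivWithinAt_Iio_iff_tendsto {f : ℝ → ℝ} {x l : ℝ} :
    HasDerivWithinAt f l (Iio x) x ↔
      Tendsto (fun h : ℝ => (f (x + h) - f x) / h) (𝓝[<] (0 : ℝ)) (𝓝 l) := by
  rw [hasDerivWithinAt_iff_tendsto_slope' (by simp)]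
  have h1 : Tendsto (fun h : ℝ => x + h) (𝓝[<] 0) (𝓝[<] x) :=
    tendsto_nhdsWithin_iff.2 ⟨tendsto_nhdsWithin_of_tendsto_nhds
      ((continuous_const.add continuous_id).tendsto' _ _ (by simp)),
      by filter_upwards [self_mem_nhdsWithin] with y hy; simpa using hy⟩
  have h2 : Tendsto (fun y : ℝ => y - x) (𝓝[<] x) (𝓝[<] 0) :=
    tendsto_nhdsWithin_iff.2 ⟨tendsto_nhdsWithin_of_tendsto_nhds
      ((continuous_id.sub continuous_const).tendsto' _ _ (by simp)),
      by filter_upwards [self_mem_nhdsWithin] with y hy; simpa using hy⟩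
  constructor
  · intro h
    refine (h.comp h1).congr fun y => ?_
    simp [slope_def_field]
  · intro h
    refine (h.comp h2).congr fun y => ?_
    simp [slope_def_field]

lemma eventually_nhdsNE_notMem_finset (J : Finset ℝ) (x : ℝ) : ∀ᶠ z in 𝓝[≠] x, z ∉ J := by
  have h := (J.finite_toSet.subset (sdiff_subset (s := (J : Set ℝ)) (t := {x}))).isClosed
  have : ((J : Set ℝ) \ {x})ᶜ ∈ 𝓝 x := h.isOpen_compl.mem_nhds (by simp)
  filter_upwards [mem_nhdsWithin_of_mem_nhds this, self_mem_nhdsWithin] with z hz hzx hzJ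
  exact hz ⟨hzJ, hzx⟩

/-- The `smooth_off` clause of `IsPC1`. -/
def SmoothOff (f : ℝ → ℝ) : Prop := ∃ J : Finset ℝ, (J : Set ℝ) ⊆ Ioo 0 1 ∧
    (∀ x ∈ Ioo (0 : ℝ) 1 \ (J : Set ℝ), DifferentiableAt ℝ f x) ∧
    ContinuousOn (deriv f) (Ioo (0 : ℝ) 1 \ (J : Set ℝ))

/-- A description of `PC¹` functions in which every clause depends on one-sided germs only. -/
lemma isPC1_iff {f : ℝ → ℝ} : IsPC1 f ↔
    (∀ x ∈ Ioc (0 : ℝ) 1, DifferentiableWithinAt ℝ f (Iio x) x) ∧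
    (∀ x ∈ Ico (0 : ℝ) 1, RightReg f x) ∧ SmoothOff f := by
  constructor
  · intro hf
    refine ⟨fun x hx => ?_, fun x hx => ?_, hf.smooth_off⟩
    · obtain ⟨l, hl⟩ := hf.left_deriv x hx
      exact (hasDerivWithinAt_Iio_iff_tendsto.2 hl).differentiableWithinAt
    · obtain ⟨J, -, hJ, -⟩ := hf.smooth_off
      have hd : ∀ᶠ z in 𝓝[>] x, DifferentiableAt ℝ f z := by
        filter_upwards [(eventually_nhdsNE_notMem_finset J x).filter_mono
          (nhdsGT_le_nhdsNE x), Ioo_mem_nhdsGT hx.2] with z hz hz'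
        exact hJ z ⟨⟨hx.1.trans_lt hz'.1, hz'.2⟩, hz⟩
      obtain ⟨l, hl⟩ := hf.right_deriv x hx
      exact ⟨hf.right_lim x hx, ⟨l, tendsto_deriv_of_tendsto_slope_prod hl hd⟩, hd⟩
  · rintro ⟨hL, hR, hS⟩
    refine ⟨fun x hx => (hL x hx).continuousWithinAt, fun x hx => (hR x hx).1, fun x hx => ?_,
      fun x hx => ⟨_, hasDerivWithinAt_Iio_iff_tendsto.1 (hL x hx).hasDerivWithinAt⟩, hS⟩
    obtain ⟨-, ⟨l, hl⟩, hd⟩ := hR x hx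
    exact ⟨l, tendsto_slope_prod_of_tendsto_deriv hl hd⟩

/-- The value at `0` is irrelevant. -/
lemma IsPC1.congr {f g : ℝ → ℝ} (hf : IsPC1 f) (h : EqOn g f (Ioc 0 1)) : IsPC1 g := by
  rw [isPC1_iff] at hf ⊢
  obtain ⟨hL, hR, J, hJ, hd, hc⟩ := hf
  have hnhds : ∀ x ∈ Ioo (0 : ℝ) 1, g =ᶠ[𝓝 x] f := fun x hx => by
    filter_upwards [Ioo_mem_nhds hx.1 hx.2] with y hy using h ⟨hy.1, hy.2.le⟩
  refine ⟨fun x hx => ?_, fun x hx => ?_, J, hJ, fun x hx => ?_, ?_⟩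
  · refine (hL x hx).congr_of_eventuallyEq ?_ (h hx)
    filter_upwards [Ioo_mem_nhdsLT hx.1] with y hy using h ⟨hy.1, hy.2.le.trans hx.2⟩
  · refine (hR x hx).congr ?_
    filter_upwards [Ioo_mem_nhdsGT hx.2] with y hy using h ⟨hx.1.trans_lt hy.1, hy.2.le⟩
  · exact (hd x hx).congr_of_eventuallyEq (hnhds x hx.1)
  · exact hc.congr fun x hx => (hnhds x hx.1).deriv_eq

/-- The end points are added to the exceptional set, so that the derivative on the open interval
needs no extension. -/
lemma IsPC1.exists_isC1Off {f : ℝ → ℝ} (hf : IsPC1 f) :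
    ∃ Ξ : Finset ℝ, 0 ∈ Ξ ∧ (Ξ : Set ℝ) ⊆ Icc 0 1 ∧ IsC1Off f Ξ := by
  obtain ⟨J, hJ, hd, hc⟩ := hf.smooth_off
  have hsub : Icc (0 : ℝ) 1 \ (↑(insert 0 (insert 1 J)) : Set ℝ) ⊆ Ioo 0 1 \ (J : Set ℝ) := by
    rintro x ⟨⟨h0, h1⟩, hx⟩
    simp only [Finset.coe_insert, mem_insert_iff, not_or] at hx
    exact ⟨⟨lt_of_le_of_ne h0 (Ne.symm hx.1), lt_of_le_of_ne h1 hx.2.1⟩, hx.2.2⟩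
  refine ⟨insert 0 (insert 1 J), by simp, ?_, fun x hx =>
    (hd x (hsub hx)).continuousAt.continuousWithinAt, deriv f, hc.mono hsub, fun x hx =>
    (hd x (hsub ⟨Ioo_subset_Icc_self hx.1, hx.2⟩)).hasDerivAt⟩
  simp only [Finset.coe_insert, insert_subset_iff]
  exact ⟨by simp, by simp, hJ.trans Ioo_subset_Icc_self⟩

lemma IsPC1.exists_upper_bound {f : ℝ → ℝ} (hf : IsPC1 f) : ∃ M : ℝ, ∀ x ∈ Ioc (0 : ℝ) 1, f x ≤ M := by
  -- Local boundedness follows from the one-sided limits; `[0,1]` is compact.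
  have key : ∃ M : ℝ, ∀ x ∈ Icc (0 : ℝ) 1, x ∈ Ioc (0 : ℝ) 1 → f x ≤ M := by
    refine isCompact_Icc.induction_on (p := fun s => ∃ M : ℝ, ∀ x ∈ s, x ∈ Ioc (0 : ℝ) 1 → f x ≤ M)
      ⟨0, by simp⟩ (fun s t hst ⟨M, hM⟩ => ⟨M, fun x hx => hM x (hst hx)⟩) ?_ ?_
    · rintro s t ⟨M, hM⟩ ⟨M', hM'⟩
      exact ⟨max M M', fun x hx hx1 => hx.elim (fun h => (hM x h hx1).trans (le_max_left _ _))
        fun h => (hM' x h hx1).trans (le_max_right _ _)⟩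
    · intro x hx
      have h1 : ∃ M, ∀ᶠ y in 𝓝[<] x, y ∈ Ioc (0 : ℝ) 1 → f y ≤ M := by
        rcases hx.1.eq_or_lt with h | h
        · refine ⟨0, ?_⟩
          filter_upwards [self_mem_nhdsWithin] with y hy hy1
          exact absurd hy1.1 (by rw [h]; exact not_lt.2 (le_of_lt hy))
        · exact ⟨f x + 1, ((hf.left_cont x ⟨h, hx.2⟩).eventually
            (eventually_le_nhds (by linarith))).mono fun _ h _ => h⟩
      have h2 : ∃ M, ∀ᶠ y in 𝓝[>] x, y ∈ Ioc (0 : ℝ) 1 → f y ≤ M := by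
        rcases hx.2.eq_or_lt with h | h
        · refine ⟨0, ?_⟩
          filter_upwards [self_mem_nhdsWithin] with y hy hy1
          exact absurd hy1.2 (by rw [← h]; exact not_le.2 hy)
        · obtain ⟨l, hl⟩ := hf.right_lim x ⟨hx.1, h⟩
          exact ⟨l + 1, (hl.eventually
            (eventually_le_nhds (by linarith))).mono fun _ h _ => h⟩
      obtain ⟨M1, h1⟩ := h1
      obtain ⟨M2, h2⟩ := h2
      rw [eventually_nhdsWithin_iff] at h1 h2
      refine ⟨_, mem_nhdsWithin_of_mem_nhds (h1.and h2), max (max M1 M2) (f x), fun y hy hy1 => ?_⟩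
      rcases lt_trichotomy y x with h | h | h
      · exact (hy.1 h hy1).trans ((le_max_left _ _).trans (le_max_left _ _))
      · rw [h]; exact le_max_right _ _
      · exact (hy.2 h hy1).trans ((le_max_right _ _).trans (le_max_left _ _))
  obtain ⟨M, hM⟩ := key
  exact ⟨M, fun x hx => hM x (Ioc_subset_Icc_self hx) hx⟩

lemma aestronglyMeasurable_of_continuousAt_off {f : ℝ → ℝ} {J : Set ℝ} (hJ : J.Finite)
    (hf : ∀ x ∉ J, ContinuousAt f x) : MeasureTheory.AEStronglyMeasurable f := by
  have h1 : ContinuousOn f Jᶜ := fun x hx => (hf x hx).continuousWithinAt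
  have h2 := h1.aestronglyMeasurable (μ := MeasureTheory.volume) hJ.measurableSet.compl
  have h3 : ∀ᵐ x : ℝ, x ∈ Jᶜ := MeasureTheory.compl_mem_ae_iff.2 (hJ.measure_zero _)
  rwa [MeasureTheory.Measure.restrict_eq_self_of_ae_mem h3] at h2

/-- A profile normalised to be defined, and bounded between positive constants, on all of `ℝ`. -/
structure IsProfile (f : ℝ → ℝ) (m M : ℝ) : Prop where
  pc1 : IsPC1 f
  pos : 0 < m
  lower : ∀ x, m ≤ f x
  upper : ∀ x, f x ≤ M
  meas : MeasureTheory.AEStronglyMeasurable f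

/-- The normalisation takes the value `f(1)` outside `(0,1]`. In particular it ignores `f(0)`, for
which no bound is assumed. -/
lemma IsPC1.exists_isProfile {f : ℝ → ℝ} (hf : IsPC1 f) (hpos : HasPosInf f (Ioc 0 1)) :
    ∃ (g : ℝ → ℝ) (m M : ℝ), EqOn g f (Ioc 0 1) ∧ IsProfile g m M := by
  obtain ⟨m, hm, hmf⟩ := hpos
  obtain ⟨M, hM⟩ := hf.exists_upper_bound
  classical
  have heq : EqOn (fun x => if x ∈ Ioc (0 : ℝ) 1 then f x else f 1) f (Ioc 0 1) :=
    fun x hx => if_pos hx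
  have h1 : (1 : ℝ) ∈ Ioc (0 : ℝ) 1 := by simp
  refine ⟨fun x => if x ∈ Ioc (0 : ℝ) 1 then f x else f 1, m, M, heq, hf.congr heq, hm,
    fun x => ?_, fun x => ?_, ?_⟩
  · by_cases hx : x ∈ Ioc (0 : ℝ) 1
    · simpa only [if_pos hx] using hmf x hx
    · simpa only [if_neg hx] using hmf 1 h1
  · by_cases hx : x ∈ Ioc (0 : ℝ) 1
    · simpa only [if_pos hx] using hM x hx
    · simpa only [if_neg hx] using hM 1 h1
  · obtain ⟨J, -, hd, -⟩ := hf.smooth_off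
    refine aestronglyMeasurable_of_continuousAt_off (J := ↑(insert 0 (insert 1 J)))
      (Finset.finite_toSet _) fun x hx => ?_
    simp only [Finset.coe_insert, mem_insert_iff, not_or] at hx
    obtain ⟨hx0, hx1, hxJ⟩ := hx
    by_cases hx : x ∈ Icc (0 : ℝ) 1
    · have hx' : x ∈ Ioo (0 : ℝ) 1 :=
        ⟨lt_of_le_of_ne hx.1 (Ne.symm hx0), lt_of_le_of_ne hx.2 hx1⟩
      refine (hd x ⟨hx', hxJ⟩).continuousAt.congr ?_
      filter_upwards [Ioo_mem_nhds hx'.1 hx'.2] with y hy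
      exact (heq ⟨hy.1, hy.2.le⟩).symm
    · refine (continuousAt_const (y := f 1)).congr ?_
      filter_upwards [isClosed_Icc.isOpen_compl.mem_nhds hx] with y hy
      exact (if_neg fun h => hy (Ioc_subset_Icc_self h)).symm

/-- The load `∫₀ᶻ f` carried by the segment `[0,z]`. -/
noncomputable def prim (f : ℝ → ℝ) (z : ℝ) : ℝ := ∫ x in (0 : ℝ)..z, f x

namespace IsProfile

variable {f : ℝ → ℝ} {m M : ℝ}

lemma pos' (hf : IsProfile f m M) (x : ℝ) : 0 < f x := hf.pos.trans_le (hf.lower x)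

lemma M_nonneg (hf : IsProfile f m M) : 0 ≤ M := (hf.pos' 0).le.trans (hf.upper 0)

lemma intervalIntegrable (hf : IsProfile f m M) (a b : ℝ) :
    IntervalIntegrable f MeasureTheory.volume a b := by
  refine (intervalIntegrable_const (c := M)).mono_fun' hf.meas.restrict
    (Eventually.of_forall fun x => ?_)
  simpa [abs_of_pos (hf.pos' x)] using hf.upper x

lemma prim_sub (hf : IsProfile f m M) (x y : ℝ) : prim f y - prim f x = ∫ z in x..y, f z :=
  intervalIntegral.integral_interval_sub_left (hf.intervalIntegrable _ _)
    (hf.intervalIntegrable _ _)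

lemma abs_prim_sub_le (hf : IsProfile f m M) (x y : ℝ) :
    |prim f y - prim f x| ≤ M * |y - x| := by
  rw [hf.prim_sub]
  have := intervalIntegral.norm_integral_le_of_norm_le_const (f := f) (C := M) (a := x) (b := y)
    fun z _ => by simpa [abs_of_pos (hf.pos' z)] using hf.upper z
  simpa using this

lemma continuous_prim (hf : IsProfile f m M) : Continuous (prim f) :=
  (LipschitzWith.of_dist_le_mul (K := ⟨M, hf.M_nonneg⟩) fun x y => by
    rw [Real.dist_eq, Real.dist_eq]; exact hf.abs_prim_sub_le y x).continuous

lemma prim_nonneg (hf : IsProfile f m M) {z : ℝ} (hz : 0 ≤ z) : 0 ≤ prim f z :=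
  intervalIntegral.integral_nonneg hz fun x _ => (hf.pos' x).le

lemma prim_pos (hf : IsProfile f m M) {z : ℝ} (hz : 0 < z) : 0 < prim f z :=
  intervalIntegral.intervalIntegral_pos_of_pos (hf.intervalIntegrable _ _) hf.pos' hz

lemma hasDerivAt_prim (hf : IsProfile f m M) {z : ℝ} (hz : ContinuousAt f z) :
    HasDerivAt (prim f) (f z) z :=
  intervalIntegral.integral_hasDerivAt_right (hf.intervalIntegrable _ _)
    ⟨univ, univ_mem, by simpa using hf.meas⟩ hz

lemma hasDerivWithinAt_prim (hf : IsProfile f m M) {z : ℝ} (hz : z ∈ Ioc (0 : ℝ) 1) :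
    HasDerivWithinAt (prim f) (f z) (Iio z) z :=
  (intervalIntegral.integral_hasDerivWithinAt_right (s := Iic z) (t := Iic z)
    (hf.intervalIntegrable _ _) ⟨univ, univ_mem, by simpa using hf.meas⟩
    (continuousWithinAt_Iio_iff_Iic.1 (hf.pc1.left_cont z hz))).mono Iio_subset_Iic_self

end IsProfile

/-! ### Characteristics and the distance they travel -/

/-- `a` is the distance travelled by the characteristics when the work load is `w`, both
considered on all of `ℝ` so that `a` is a `C¹` diffeomorphism of the line. -/
structure IsClock (lam w a : ℝ → ℝ) : Prop where
  cont : Continuous w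
  pos : ∀ t, 0 < w t
  bdd : ∃ B, ∀ t, w t ≤ B
  start : a 0 = 0
  deriv : ∀ t, HasDerivAt a (lam (w t)) t

namespace IsClock

variable {lam w a : ℝ → ℝ} {K : ℝ}

lemma continuous_speed (hc : IsClock lam w a) (hl : IsSpeed lam K) :
    Continuous fun t => lam (w t) :=
  hl.continuousOn.comp_continuous hc.cont fun t => (hc.pos t).le

lemma speed_pos (hc : IsClock lam w a) (hl : IsSpeed lam K) (t : ℝ) : 0 < lam (w t) :=
  hl.pos _ (hc.pos t).le

lemma continuous (hc : IsClock lam w a) : Continuous a :=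
  continuous_iff_continuousAt.2 fun t => (hc.deriv t).continuousAt

lemma strictMono (hc : IsClock lam w a) (hl : IsSpeed lam K) : StrictMono a :=
  strictMono_of_deriv_pos fun t => by rw [(hc.deriv t).deriv]; exact hc.speed_pos hl t

lemma le_mul_sub (hc : IsClock lam w a) (hl : IsSpeed lam K) {s t : ℝ} (hst : s ≤ t) :
    a t - a s ≤ lam 0 * (t - s) :=
  Convex.image_sub_le_mul_sub_of_deriv_le convex_univ hc.continuous.continuousOn
    (fun t _ => (hc.deriv t).differentiableAt.differentiableWithinAt)
    (fun t _ => by rw [(hc.deriv t).deriv]; exact hl.le_zero (hc.pos t).le)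
    s (mem_univ _) t (mem_univ _) hst

lemma mul_sub_le (hc : IsClock lam w a) {s t c : ℝ} (hst : s ≤ t)
    (h : ∀ r ∈ Ioo s t, c ≤ lam (w r)) : c * (t - s) ≤ a t - a s :=
  Convex.mul_sub_le_image_sub_of_le_deriv (convex_Icc s t) hc.continuous.continuousOn
    (fun t _ => (hc.deriv t).differentiableAt.differentiableWithinAt)
    (fun r hr => by rw [(hc.deriv r).deriv]; exact h r (by simpa using hr))
    s (left_mem_Icc.2 hst) t (right_mem_Icc.2 hst) hst

lemma nonneg (hc : IsClock lam w a) (hl : IsSpeed lam K) {t : ℝ} (ht : 0 ≤ t) : 0 ≤ a t :=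
  hc.start ▸ (hc.strictMono hl).monotone ht

lemma le_mul (hc : IsClock lam w a) (hl : IsSpeed lam K) {t : ℝ} (ht : 0 ≤ t) :
    a t ≤ lam 0 * t := by
  simpa [hc.start] using hc.le_mul_sub hl ht

lemma le_one (hc : IsClock lam w a) (hl : IsSpeed lam K) {t : ℝ} (ht : t ∈ Icc 0 (1 / lam 0)) :
    a t ≤ 1 := by
  have h1 := hc.le_mul hl ht.1
  have h2 := mul_le_mul_of_nonneg_left ht.2 hl.zero_pos.le
  rw [mul_one_div_cancel hl.zero_pos.ne'] at h2
  linarith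

lemma surjective (hc : IsClock lam w a) (hl : IsSpeed lam K) : Function.Surjective a := by
  obtain ⟨B, hB⟩ := hc.bdd
  have hB0 : 0 ≤ B := (hc.pos 0).le.trans (hB 0)
  have hp := hl.pos B hB0
  have hlow : ∀ r, lam B ≤ lam (w r) := fun r => hl.anti (hc.pos r).le hB0 (hB r)
  refine hc.continuous.surjective ?_ ?_
  · refine tendsto_atTop_mono' _ ?_ (tendsto_id.const_mul_atTop hp)
    filter_upwards [eventually_ge_atTop 0] with t ht
    simpa [hc.start] using hc.mul_sub_le ht (fun r _ => hlow r)
  · refine tendsto_atBot_mono' _ ?_ (tendsto_id.const_mul_atBot hp)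
    filter_upwards [eventually_le_atBot 0] with t ht
    have := hc.mul_sub_le ht (fun r _ => hlow r)
    simp only [hc.start, id] at *
    linarith

/-- The inverse `θ` of the travelled distance. -/
lemma exists_inverse (hc : IsClock lam w a) (hl : IsSpeed lam K) :
    ∃ θ : ℝ → ℝ, (∀ z, a (θ z) = z) ∧ (∀ t, θ (a t) = t) ∧ StrictMono θ ∧
      ∀ z, HasDerivAt θ (lam (w (θ z)))⁻¹ z := by
  let e := (hc.strictMono hl).orderIsoOfSurjective a (hc.surjective hl)
  have h1 : ∀ z, a (e.symm z) = z := fun z => e.apply_symm_apply z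
  refine ⟨e.symm, h1, fun t => e.symm_apply_apply t, e.symm.strictMono, fun z => ?_⟩
  exact HasDerivAt.of_local_left_inverse e.symm.continuous.continuousAt (hc.deriv _)
    (hc.speed_pos hl _).ne' (Eventually.of_forall h1)

end IsClock

/-- The method of characteristics: up to time `h`, `y(t,·)` consists of the initial profile `f`
shifted by `a(t)`, followed by the values `u / λ(w(s))` that entered at the times `s ≤ t`. -/
structure Represents (lam w a : ℝ → ℝ) (h u : ℝ) (f : ℝ → ℝ) (y : ℝ → ℝ → ℝ) : Prop where
  shifted : ∀ t ∈ Icc 0 h, ∀ x ∈ Ioc (a t) 1, y t x = f (x - a t)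
  inflow : ∀ t ∈ Icc 0 h, ∀ s ∈ Icc 0 t, y t (a t - a s) = u / lam (w s)

section Representation

variable {lam w a : ℝ → ℝ} {K u m M : ℝ} {f : ℝ → ℝ} {y : ℝ → ℝ → ℝ}

/-- Every point `(t,x)` lies on a characteristic issued from the initial line or from `x = 0`. -/
lemma IsClock.exists_foot (hc : IsClock lam w a) (hl : IsSpeed lam K) {t x : ℝ}
    (hx : x ∈ Icc 0 (a t)) : ∃ s ∈ Icc 0 t, x = a t - a s := by
  obtain ⟨s, hs⟩ := hc.surjective hl (a t - x)
  refine ⟨s, ⟨?_, ?_⟩, by rw [hs]; ring⟩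
  · rw [← (hc.strictMono hl).le_iff_le, hs, hc.start]; linarith [hx.2]
  · rw [← (hc.strictMono hl).le_iff_le, hs]; linarith [hx.1]

/-- Conservation of mass: up to time `t` the mass `u t` has entered, and the part of `f` on
`(1 - a(t), 1]` has left. -/
lemma Represents.workload_eq (hr : Represents lam w a (1 / lam 0) u f y) (hl : IsSpeed lam K)
    (hc : IsClock lam w a) (hf : IsProfile f m M) {t : ℝ} (ht : t ∈ Icc 0 (1 / lam 0)) :
    workload y t = u * t + prim f (1 - a t) := by
  have ha0 := hc.nonneg hl ht.1
  have ha1 := hc.le_one hl ht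
  have hcont : ContinuousOn (fun s => a t - a s) (uIcc 0 t) :=
    (continuous_const.sub hc.continuous).continuousOn
  have hder : ∀ s ∈ Ioo (min 0 t) (max 0 t), HasDerivAt (fun s => a t - a s) (-lam (w s)) s :=
    fun s _ => (hc.deriv s).const_sub (a t)
  have hneg : ∀ s ∈ Ioo (min 0 t) (max 0 t), -lam (w s) ≤ 0 :=
    fun s _ => by linarith [hc.speed_pos hl s]
  have hcongr : ∀ s ∈ uIcc 0 t,
      (y t ∘ fun s => a t - a s) s * -lam (w s) = -u := fun s hs => by
    rw [uIcc_of_le ht.1] at hs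
    have := (hc.speed_pos hl s).ne'
    simp only [Function.comp, hr.inflow t ht s hs]
    field_simp
  have hint := (intervalIntegral.integrable_comp_mul_deriv_iff_of_deriv_nonpos (g := y t)
    hcont hder hneg).1 ((intervalIntegrable_const (c := -u)).congr fun s hs =>
      (hcongr s (uIoc_subset_uIcc hs)).symm)
  -- Substituting `x = a(t) - a(s)` turns the mass that has entered into `∫₀ᵗ u ds`.
  have h1 := intervalIntegral.integral_comp_mul_deriv_of_deriv_nonpos (g := y t) hcont hder hneg
  rw [intervalIntegral.integral_congr hcongr] at h1
  simp only [hc.start, sub_zero, sub_self, intervalIntegral.integral_const, smul_eq_mul] at h1 hint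
  have hcongr2 : ∀ x ∈ uIoc (a t) 1, y t x = f (x - a t) := fun x hx =>
    hr.shifted t ht x (by rwa [uIoc_of_le ha1] at hx)
  have hint2 : IntervalIntegrable (y t) MeasureTheory.volume (a t) 1 := by
    have := (hf.intervalIntegrable 0 (1 - a t)).comp_sub_right (a t)
    simp only [zero_add, sub_add_cancel] at this
    exact this.congr fun x hx => (hcongr2 x hx).symm
  have h2 : ∫ x in (a t)..1, y t x = prim f (1 - a t) := by
    rw [intervalIntegral.integral_congr_Ioo_of_le ha1 fun x hx =>
      hcongr2 x (by rw [uIoc_of_le ha1]; exact Ioo_subset_Ioc_self hx),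
      intervalIntegral.integral_comp_sub_right (fun x => f x)]
    simp [prim]
  rw [workload, ← intervalIntegral.integral_add_adjacent_intervals hint.symm hint2, h2,
    intervalIntegral.integral_symm, ← h1]
  ring

end Representation

/-! ### Uniqueness for the plant -/

lemma IsC1Off.congr {f g : ℝ → ℝ} {Ξ : Finset ℝ} (hf : IsC1Off f Ξ) (h0 : 0 ∈ Ξ)
    (h : EqOn g f (Ioc 0 1)) : IsC1Off g Ξ := by
  obtain ⟨hc, d, hd, hd'⟩ := hf
  refine ⟨hc.congr fun x hx => h ⟨lt_of_le_of_ne hx.1.1 ?_, hx.1.2⟩, d, hd, fun x hx => ?_⟩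
  · rintro rfl; exact hx.2 h0
  · refine (hd' x hx).congr_of_eventuallyEq ?_
    filter_upwards [Ioo_mem_nhds hx.1.1 hx.1.2] with z hz using h ⟨hz.1, hz.2.le⟩

lemma IsIBVPSolution.congr {lam : ℝ → ℝ} {h u : ℝ} {f g : ℝ → ℝ} {y : ℝ → ℝ → ℝ}
    (hy : IsIBVPSolution lam h u f y) (hfg : EqOn g f (Ioc 0 1)) :
    IsIBVPSolution lam h u g y where
  profile := hy.profile
  pos := hy.pos
  workload_cont := hy.workload_cont
  pde Ξ h0 hΞ hg := hy.pde Ξ h0 hΞ (hg.congr h0 hfg.symm)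
  boundary := hy.boundary
  initial x hx := (hy.initial x hx).trans (hfg hx).symm

lemma workload_congr {y y' : ℝ → ℝ → ℝ} {t t' : ℝ} (h : EqOn (y t) (y' t') (Ioc 0 1)) :
    workload y t = workload y' t' :=
  intervalIntegral.integral_congr_Ioo_of_le zero_le_one (h.mono Ioo_subset_Ioc_self)

lemma workload_pos {y : ℝ → ℝ → ℝ} {t : ℝ} (h : IsPC1 (y t)) (h' : HasPosInf (y t) (Ioc 0 1)) :
    0 < workload y t := by
  obtain ⟨g, m, M, hg, hgp⟩ := h.exists_isProfile h'
  rw [workload_congr (y' := fun _ => g) (t' := 0) hg.symm]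
  exact hgp.prim_pos one_pos

lemma HasPosInf.mono {f : ℝ → ℝ} {S T : Set ℝ} (h : HasPosInf f T) (hST : S ⊆ T) :
    HasPosInf f S :=
  let ⟨m, hm, hmf⟩ := h
  ⟨m, hm, fun x hx => hmf x (hST hx)⟩

namespace IsIBVPSolution

variable {lam : ℝ → ℝ} {K h u : ℝ} {f : ℝ → ℝ} {y : ℝ → ℝ → ℝ}

lemma workload_pos (hy : IsIBVPSolution lam h u f y) {t : ℝ} (ht : t ∈ Icc 0 h) :
    0 < workload y t :=
  Reentrant.workload_pos (hy.profile t ht) ((hy.pos t ht).mono Ioc_subset_Icc_self)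

/-- The clock of a solution on `[0,h]`: outside this interval the work load is continued by its
values at the end points. -/
lemma exists_isClock (hy : IsIBVPSolution lam h u f y) (hl : IsSpeed lam K) (hh : 0 ≤ h) :
    ∃ w a : ℝ → ℝ, IsClock lam w a ∧ EqOn w (workload y) (Icc 0 h) ∧
      EqOn a (travel lam y) (Icc 0 h) := by
  have hmem : ∀ t, max 0 (min t h) ∈ Icc 0 h := fun t =>
    ⟨le_max_left _ _, max_le hh (min_le_right _ _)⟩
  have hid : ∀ t ∈ Icc 0 h, max 0 (min t h) = t := fun t ht => by
    rw [min_eq_left ht.2, max_eq_right ht.1]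
  have hw : Continuous fun t => workload y (max 0 (min t h)) :=
    hy.workload_cont.comp_continuous (by fun_prop) hmem
  have hpos : ∀ t, 0 < workload y (max 0 (min t h)) := fun t => hy.workload_pos (hmem t)
  have hlw : Continuous fun t => lam (workload y (max 0 (min t h))) :=
    hl.continuousOn.comp_continuous hw fun t => (hpos t).le
  obtain ⟨B, hB⟩ := isCompact_Icc.bddAbove_image hy.workload_cont
  refine ⟨fun t => workload y (max 0 (min t h)),
    fun t => ∫ s in (0 : ℝ)..t, lam (workload y (max 0 (min s h))),
    ⟨hw, hpos, ⟨B, fun t => hB (mem_image_of_mem _ (hmem t))⟩, by simp, fun t =>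
      hlw.integral_hasStrictDerivAt 0 t |>.hasDerivAt⟩, fun t ht => by
      simp only [hid t ht], fun t ht => ?_⟩
  refine intervalIntegral.integral_congr fun s hs => ?_
  rw [uIcc_of_le ht.1] at hs
  simp only [hid s ⟨hs.1, hs.2.trans ht.2⟩]

/-- A solution is constant along each characteristic that carries no singularity. The singular
curves of both kinds are characteristics themselves, `z ∈ Ξ` and `z + 1 ∈ Ξ`. -/
lemma eq_along (hy : IsIBVPSolution lam h u f y) {w a : ℝ → ℝ}
    (hl : IsSpeed lam K) (hc : IsClock lam w a) (hw : EqOn w (workload y) (Icc 0 h))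
    (ha : EqOn a (travel lam y) (Icc 0 h)) {Ξ : Finset ℝ} (h0 : 0 ∈ Ξ)
    (hΞ : (Ξ : Set ℝ) ⊆ Icc 0 1) (hfΞ : IsC1Off f Ξ) {z t₁ t₂ : ℝ} (hz : z ∉ Ξ) (hz' : z + 1 ∉ Ξ)
    (h1 : 0 ≤ t₁) (h12 : t₁ ≤ t₂) (h2 : t₂ ≤ h) (hz1 : 0 ≤ z + a t₁) (hz2 : z + a t₂ ≤ 1) :
    y t₁ (z + a t₁) = y t₂ (z + a t₂) := by
  rcases h12.eq_or_lt with rfl | h12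
  · rfl
  obtain ⟨hcont, yt, yx, -, -, hder, hpde⟩ := hy.pde Ξ h0 hΞ hfΞ
  have hmono := hc.strictMono hl
  have hA : ∀ t x, t ∈ Icc 0 h → x ∈ Icc (0 : ℝ) 1 → x - a t ∉ Ξ → x - a t + 1 ∉ Ξ →
      (t, x) ∈ (Icc 0 h ×ˢ Icc (0 : ℝ) 1) \ singularSet lam y Ξ h := by
    rintro t x ht hx hx1 hx2
    refine ⟨⟨ht, hx⟩, ?_⟩
    rintro ⟨-, ξ, hξ, ⟨-, h'⟩ | ⟨-, -, h'⟩⟩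
    · refine hx1 ?_
      have : x - a t = ξ := by rw [ha ht]; simp only at h'; linarith
      rwa [this]
    · refine hx2 ?_
      have : x - a t + 1 = ξ := by rw [ha ht]; simp only at h'; linarith
      rwa [this]
  -- The regular points of the open rectangle form an open set: its complement there is given by
  -- the condition that `x - a(t)` or `x - a(t) + 1` belongs to the finite set `Ξ`.
  have hin : ∀ t ∈ Ioo t₁ t₂, (t, z + a t) ∈
      interior ((Icc 0 h ×ˢ Icc (0 : ℝ) 1) \ singularSet lam y Ξ h) := by
    intro t ht
    refine mem_interior.2 ⟨(Ioo 0 h ×ˢ Ioo (0 : ℝ) 1) ∩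
      {p | p.2 - a p.1 ∈ (Ξ : Set ℝ)ᶜ} ∩ {p | p.2 - a p.1 + 1 ∈ (Ξ : Set ℝ)ᶜ}, ?_, ?_, ?_⟩
    · rintro ⟨t, x⟩ ⟨⟨⟨ht, hx⟩, h3⟩, h4⟩
      exact hA t x (Ioo_subset_Icc_self ht) (Ioo_subset_Icc_self hx) h3 h4
    · have ho : IsOpen (Ξ : Set ℝ)ᶜ := Ξ.finite_toSet.isClosed.isOpen_compl
      have hac := hc.continuous
      exact ((isOpen_Ioo.prod isOpen_Ioo).inter (ho.preimage (by fun_prop))).inter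
        (ho.preimage (by fun_prop))
    · refine ⟨⟨⟨⟨h1.trans_lt ht.1, ht.2.trans_le h2⟩, ?_, ?_⟩, ?_⟩, ?_⟩
      · have := hmono ht.1; simp only; linarith
      · have := hmono ht.2; simp only; linarith
      · simpa using hz
      · simpa using hz'
  have hcont' : ContinuousOn (fun t => y t (z + a t)) (Icc t₁ t₂) := by
    refine hcont.comp (f := fun t => (t, z + a t))
      (continuous_id.prodMk (continuous_const.add hc.continuous)).continuousOn fun t ht => ?_
    have hm1 := hmono.monotone ht.1
    have hm2 := hmono.monotone ht.2
    exact hA t _ ⟨h1.trans ht.1, ht.2.trans h2⟩ ⟨by linarith, by linarith⟩ (by simpa using hz)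
      (by simpa using hz')
  have hder' : ∀ t ∈ Ioo t₁ t₂, HasDerivAt (fun t => y t (z + a t)) 0 t := by
    intro t ht
    have hp := hin t ht
    have h3 : HasDerivAt (fun t => (t, z + a t)) (1, lam (w t)) t :=
      (hasDerivAt_id t).prodMk ((hc.deriv t).const_add z)
    have h4 := (hder _ hp).comp_hasDerivAt t h3
    have h5 := hpde _ (interior_subset hp)
    rw [← hw ⟨h1.trans ht.1.le, ht.2.le.trans h2⟩] at h5
    refine h4.congr_deriv ?_
    change yt _ * 1 + yx _ * lam (w t) = 0
    linarith
  obtain ⟨c, hc', hc2⟩ := exists_hasDerivAt_eq_slope _ _ h12 hcont' hder'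
  rw [eq_comm, div_eq_zero_iff] at hc2
  rcases hc2 with hc2 | hc2
  · linarith
  · linarith

/-- Every solution is given by the method of characteristics; on the finitely many singular
characteristics this follows from the left-continuity of the profiles. -/
lemma represents (hy : IsIBVPSolution lam (1 / lam 0) u f y) {w a : ℝ → ℝ}
    (hl : IsSpeed lam K) (hf : IsPC1 f) (hc : IsClock lam w a)
    (hw : EqOn w (workload y) (Icc 0 (1 / lam 0)))
    (ha : EqOn a (travel lam y) (Icc 0 (1 / lam 0))) :
    Represents lam w a (1 / lam 0) u f y := by
  obtain ⟨Ξ, h0, hΞ, hfΞ⟩ := hf.exists_isC1Off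
  have hmono := hc.strictMono hl
  have hb : ∀ t ∈ Icc 0 (1 / lam 0), y t 0 = u / lam (w t) := fun t ht => by
    rw [eq_div_iff (hc.speed_pos hl t).ne', hw ht]
    exact hy.boundary t ht
  constructor
  · intro t ht x hx
    have hat := hc.nonneg hl ht.1
    have hL := (hy.profile t ht).left_cont x ⟨hat.trans_lt hx.1, hx.2⟩
    have hR : Tendsto (fun x' => f (x' - a t)) (𝓝[<] x) (𝓝 (f (x - a t))) := by
      refine (hf.left_cont (x - a t) ⟨by linarith [hx.1], by linarith [hx.2]⟩).comp ?_
      exact tendsto_nhdsWithin_iff.2 ⟨tendsto_nhdsWithin_of_tendsto_nhds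
        ((continuous_id.sub continuous_const).tendsto' _ _ (by simp)),
        by filter_upwards [self_mem_nhdsWithin] with y hy; simpa using hy⟩
    refine tendsto_nhds_unique_of_eventuallyEq hL hR ?_
    filter_upwards [(eventually_nhdsNE_notMem_finset (Ξ.image fun ξ => ξ + a t) x).filter_mono
      (nhdsLT_le_nhdsNE x), Ioo_mem_nhdsLT hx.1] with x' hx' hx'2
    have hz : x' - a t ∉ Ξ := fun h => hx' (Finset.mem_image.2 ⟨_, h, by ring⟩)
    have hz' : x' - a t + 1 ∉ Ξ := fun h => by linarith [(hΞ h).2, hx'2.1]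
    have := hy.eq_along hl hc hw ha h0 hΞ hfΞ hz hz' le_rfl ht.1 ht.2
      (by rw [hc.start]; linarith [hx'2.1]) (by linarith [hx'2.2, hx.2])
    rw [hc.start, add_zero, sub_add_cancel] at this
    rw [← this]
    exact hy.initial _ ⟨by linarith [hx'2.1], by linarith [hx'2.2, hx.2]⟩
  · intro t ht s hs
    have hat := hc.le_one hl ht
    rcases hs.2.eq_or_lt with rfl | hst
    · rw [sub_self]; exact hb _ ht
    obtain ⟨θ, hθ1, hθ2, hθm, hθd⟩ := hc.exists_inverse hl
    have has := hc.nonneg hl hs.1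
    have hx0 : 0 < a t - a s := sub_pos.2 (hmono hst)
    have hL := (hy.profile t ht).left_cont (a t - a s) ⟨hx0, by linarith⟩
    have hθc : Continuous θ := continuous_iff_continuousAt.2 fun z => (hθd z).continuousAt
    have hR : Tendsto (fun x => u / lam (w (θ (a t - x)))) (𝓝[<] (a t - a s))
        (𝓝 (u / lam (w s))) := by
      refine tendsto_nhdsWithin_of_tendsto_nhds (Continuous.tendsto' ?_ _ _ ?_)
      · exact continuous_const.div
          ((hc.continuous_speed hl).comp (hθc.comp (continuous_const.sub continuous_id)))
          fun x => (hc.speed_pos hl _).ne'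
      · simp [hθ2]
    refine tendsto_nhds_unique_of_eventuallyEq hL hR ?_
    filter_upwards [(eventually_nhdsNE_notMem_finset (Ξ.image fun ξ => ξ - 1 + a t) _).filter_mono
      (nhdsLT_le_nhdsNE _), Ioo_mem_nhdsLT hx0] with x hx hx2
    have hz' : x - a t + 1 ∉ Ξ := fun h => hx (Finset.mem_image.2 ⟨_, h, by ring⟩)
    have hz : x - a t ∉ Ξ := fun h => by linarith [(hΞ h).1, hx2.2]
    have hs' : θ (a t - x) ∈ Icc 0 t := by
      constructor
      · rw [← hmono.le_iff_le, hθ1, hc.start]; linarith [hx2.2]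
      · rw [← hmono.le_iff_le, hθ1]; linarith [hx2.1]
    have := hy.eq_along hl hc hw ha h0 hΞ hfΞ hz hz' hs'.1 hs'.2 ht.2
      (by rw [hθ1]; linarith) (by linarith [hx2.2])
    rw [hθ1, sub_add_cancel, sub_add_sub_cancel, sub_self] at this
    rw [← this]
    exact hb _ ⟨hs'.1, hs'.2.trans ht.2⟩

end IsIBVPSolution

/-- The closed equation `a' = λ(u t + ∫₀^{1-a} f)` for the travelled distance; its right-hand side
is made globally Lipschitz by continuing `λ` to negative arguments. -/
noncomputable def clockField (lam : ℝ → ℝ) (u : ℝ) (f : ℝ → ℝ) (t a : ℝ) : ℝ :=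
  lam (max 0 (u * t + prim f (1 - a)))

section

variable {lam : ℝ → ℝ} {K u m M : ℝ} {f : ℝ → ℝ}

lemma abs_clockField_sub_le (hl : IsSpeed lam K) (hf : IsProfile f m M) (t a b : ℝ) :
    |clockField lam u f t a - clockField lam u f t b| ≤ K * M * |a - b| := by
  refine (hl.abs_sub_le_max _ _).trans ?_
  rw [mul_assoc, add_sub_add_left_eq_sub]
  refine mul_le_mul_of_nonneg_left ((hf.abs_prim_sub_le _ _).trans_eq ?_) hl.nonneg_const
  rw [sub_sub_sub_cancel_left, abs_sub_comm]

lemma lipschitzWith_clockField (hl : IsSpeed lam K) (hf : IsProfile f m M) (t : ℝ) :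
    LipschitzWith ⟨K * M, mul_nonneg hl.nonneg_const hf.M_nonneg⟩ (clockField lam u f t) :=
  LipschitzWith.of_dist_le_mul fun a b => by
    rw [Real.dist_eq, Real.dist_eq]; exact abs_clockField_sub_le hl hf t a b

lemma Represents.hasDerivAt_clock {w a : ℝ → ℝ} {y : ℝ → ℝ → ℝ} (hl : IsSpeed lam K)
    (hf : IsProfile f m M) (hc : IsClock lam w a) (hr : Represents lam w a (1 / lam 0) u f y)
    (hw : EqOn w (workload y) (Icc 0 (1 / lam 0))) {t : ℝ} (ht : t ∈ Icc 0 (1 / lam 0)) :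
    HasDerivAt a (clockField lam u f t (a t)) t := by
  have := hc.deriv t
  rwa [clockField, ← hr.workload_eq hl hc hf ht, ← hw ht, max_eq_right (hc.pos t).le]

/-- Uniqueness for the plant. -/
theorem IsIBVPSolution.eqOn {y y' : ℝ → ℝ → ℝ} (hl : IsSpeed lam K) (hf : IsProfile f m M)
    (hy : IsIBVPSolution lam (1 / lam 0) u f y) (hy' : IsIBVPSolution lam (1 / lam 0) u f y')
    {t : ℝ} (ht : t ∈ Icc 0 (1 / lam 0)) : EqOn (y t) (y' t) (Icc 0 1) := by
  have hh : 0 ≤ 1 / lam 0 := (one_div_pos.2 hl.zero_pos).le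
  obtain ⟨w, a, hc, hw, ha⟩ := hy.exists_isClock hl hh
  obtain ⟨w', a', hc', hw', ha'⟩ := hy'.exists_isClock hl hh
  have hr := hy.represents hl hf.pc1 hc hw ha
  have hr' := hy'.represents hl hf.pc1 hc' hw' ha'
  have haa : EqOn a a' (Icc 0 (1 / lam 0)) :=
    ODE_solution_unique (fun t => lipschitzWith_clockField (u := u) hl hf t)
      hc.continuous.continuousOn
      (fun t ht => (hr.hasDerivAt_clock hl hf hc hw (Ico_subset_Icc_self ht)).hasDerivWithinAt)
      hc'.continuous.continuousOn
      (fun t ht => (hr'.hasDerivAt_clock hl hf hc' hw' (Ico_subset_Icc_self ht)).hasDerivWithinAt)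
      (by rw [hc.start, hc'.start])
  have hww : EqOn w w' (Icc 0 (1 / lam 0)) := fun t ht => by
    rw [hw ht, hw' ht, hr.workload_eq hl hc hf ht, hr'.workload_eq hl hc' hf ht, haa ht]
  intro x hx
  rcases lt_or_ge (a t) x with h | h
  · rw [hr.shifted t ht x ⟨h, hx.2⟩, hr'.shifted t ht x ⟨haa ht ▸ h, hx.2⟩, haa ht]
  · obtain ⟨s, hs, rfl⟩ := hc.exists_foot hl ⟨hx.1, h⟩
    have hs' : s ∈ Icc 0 (1 / lam 0) := ⟨hs.1, hs.2.trans ht.2⟩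
    rw [hr.inflow t ht s hs, hww hs', haa ht, haa hs', hr'.inflow t ht s hs]

end

/-! ### Existence for the plant -/

section Existence

variable {lam : ℝ → ℝ} {K u m M : ℝ} {f : ℝ → ℝ}

/-- The travelled distance, obtained from the Picard–Lindelöf theorem. The time horizon `1/λ(0)`
is short enough for it to stay in `[0,1]`. -/
lemma exists_clock (hl : IsSpeed lam K) (hf : IsProfile f m M) (hu : 0 < u) :
    ∃ w a : ℝ → ℝ, IsClock lam w a ∧
      ∀ t ∈ Icc 0 (1 / lam 0), w t = u * t + prim f (1 - a t) := by
  set h := 1 / lam 0 with hh_def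
  have hh : 0 < h := one_div_pos.2 hl.zero_pos
  have hlh : lam 0 * h = 1 := mul_one_div_cancel hl.zero_pos.ne'
  have hrange : ∀ t x, 0 < clockField lam u f t x ∧ clockField lam u f t x ≤ lam 0 := fun t x =>
    ⟨hl.pos _ (le_max_left _ _), hl.le_zero (le_max_left _ _)⟩
  have hPL : IsPicardLindelof (clockField lam u f) (tmin := 0) (tmax := h)
      ⟨0, left_mem_Icc.2 hh.le⟩ 0 1 0 (lam 0).toNNReal
      ⟨K * M, mul_nonneg hl.nonneg_const hf.M_nonneg⟩ :=
    { lipschitzOnWith := fun t _ => (lipschitzWith_clockField hl hf t).lipschitzOnWith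
      continuousOn := fun x _ => by
        refine (hl.continuousOn.comp_continuous (f := fun t => max 0 (u * t + prim f (1 - x)))
          (by fun_prop) fun t => mem_Ici.2 (le_max_left _ _)).continuousOn
      norm_le := fun t _ x _ => by
        rw [Real.norm_eq_abs, abs_of_pos (hrange t x).1, Real.coe_toNNReal _ hl.zero_pos.le]
        exact (hrange t x).2
      mul_max_le := by
        simp only [sub_zero, sub_self, NNReal.coe_one, NNReal.coe_zero]
        rw [Real.coe_toNNReal _ hl.zero_pos.le, max_eq_left hh.le, hlh] }
  obtain ⟨α, hα0, hα⟩ := hPL.exists_eq_forall_mem_Icc_hasDerivWithinAt₀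
  simp only at hα0
  have hαc : ContinuousOn α (Icc 0 h) := fun t ht => (hα t ht).continuousWithinAt
  have hα' : ∀ t ∈ Ioo 0 h, HasDerivAt α (clockField lam u f t (α t)) t := fun t ht =>
    (hα t (Ioo_subset_Icc_self ht)).hasDerivAt (Icc_mem_nhds ht.1 ht.2)
  have hα1 : ∀ t ∈ Icc 0 h, α t ≤ 1 := fun t ht => by
    have := Convex.image_sub_le_mul_sub_of_deriv_le (convex_Icc 0 h) (f := α) (C := lam 0) hαc
      (fun t ht => by
        rw [interior_Icc] at ht; exact (hα' t ht).differentiableAt.differentiableWithinAt)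
      (fun t ht => by rw [interior_Icc] at ht; rw [(hα' t ht).deriv]; exact (hrange _ _).2)
      0 (left_mem_Icc.2 hh.le) t ht ht.1
    have h2 := mul_le_mul_of_nonneg_left ht.2 hl.zero_pos.le
    rw [hα0] at this
    linarith
  have hpos : ∀ t ∈ Icc 0 h, 0 < u * t + prim f (1 - α t) := fun t ht => by
    rcases ht.1.eq_or_lt with rfl | h0
    · rw [hα0, mul_zero, zero_add, sub_zero]; exact hf.prim_pos one_pos
    · exact add_pos_of_pos_of_nonneg (mul_pos hu h0) (hf.prim_nonneg (by linarith [hα1 t ht]))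
  have hmem : ∀ t, max 0 (min t h) ∈ Icc 0 h := fun t =>
    ⟨le_max_left _ _, max_le hh.le (min_le_right _ _)⟩
  have hid : ∀ t ∈ Icc 0 h, max 0 (min t h) = t := fun t ht => by
    rw [min_eq_left ht.2, max_eq_right ht.1]
  let w₀ : ℝ → ℝ := fun t => u * t + prim f (1 - α t)
  have hw₀ : ContinuousOn w₀ (Icc 0 h) :=
    (continuousOn_const.mul continuousOn_id).add
      (hf.continuous_prim.comp_continuousOn (continuousOn_const.sub hαc))
  have hw : Continuous fun t => w₀ (max 0 (min t h)) :=
    hw₀.comp_continuous (by fun_prop) hmem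
  have hlw : Continuous fun t => lam (w₀ (max 0 (min t h))) :=
    hl.continuousOn.comp_continuous hw fun t => (hpos _ (hmem t)).le
  obtain ⟨B, hB⟩ := isCompact_Icc.bddAbove_image hw₀
  refine ⟨fun t => w₀ (max 0 (min t h)), fun t => ∫ s in (0 : ℝ)..t, lam (w₀ (max 0 (min s h))),
    ⟨hw, fun t => hpos _ (hmem t), ⟨B, fun t => hB (mem_image_of_mem _ (hmem t))⟩, by simp,
      fun t => (hlw.integral_hasStrictDerivAt 0 t).hasDerivAt⟩, fun t ht => ?_⟩
  have : ∫ s in (0 : ℝ)..t, lam (w₀ (max 0 (min s h))) = α t := by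
    rw [intervalIntegral.integral_eq_sub_of_hasDerivAt_of_le ht.1
      (hαc.mono (Icc_subset_Icc_right ht.2)) (fun s hs => ?_) (hlw.intervalIntegrable _ _),
      hα0, sub_zero]
    have hs' : s ∈ Ioo 0 h := ⟨hs.1, hs.2.trans_le ht.2⟩
    have h1 := hα' s hs'
    rw [clockField, max_eq_right (hpos s (Ioo_subset_Icc_self hs')).le] at h1
    rwa [hid s (Ioo_subset_Icc_self hs')]
  simp only [this, hid t ht, w₀]

/-- `θ` is the inverse of a travelled distance, with derivative `v`. -/
structure IsArrivalTime (θ v : ℝ → ℝ) : Prop where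
  zero : θ 0 = 0
  mono : StrictMono θ
  deriv : ∀ z, HasDerivAt θ (v z) z
  cont : Continuous v

/-- The work load at the time when the particle now at the characteristic coordinate `z ≤ 0`
entered. -/
noncomputable def entryLoad (u : ℝ) (θ f : ℝ → ℝ) (z : ℝ) : ℝ := u * θ (-z) + prim f (1 + z)

/-- The density as a function of the characteristic coordinate `z = x - a(t)`. -/
noncomputable def charProfile (lam : ℝ → ℝ) (u : ℝ) (θ f : ℝ → ℝ) (z : ℝ) : ℝ :=
  open Classical in if 0 < z then f z else u / lam (entryLoad u θ f z)

/-- The derivative of `entryLoad`. -/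
noncomputable def entryLoadDeriv (u : ℝ) (v f : ℝ → ℝ) (z : ℝ) : ℝ := -(u * v (-z)) + f (1 + z)

/-- The derivative of `u / λ(entryLoad)`. -/
noncomputable def entryDeriv (lam : ℝ → ℝ) (u : ℝ) (θ v f : ℝ → ℝ) (z : ℝ) : ℝ :=
  -(u * (derivWithin lam (Ici 0) (entryLoad u θ f z) * entryLoadDeriv u v f z)) /
    lam (entryLoad u θ f z) ^ 2

variable {θ v : ℝ → ℝ}

lemma charProfile_of_pos {z : ℝ} (hz : 0 < z) : charProfile lam u θ f z = f z := if_pos hz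

lemma charProfile_of_nonpos {z : ℝ} (hz : z ≤ 0) :
    charProfile lam u θ f z = u / lam (entryLoad u θ f z) := if_neg hz.not_gt

namespace IsArrivalTime

lemma continuous (hθ : IsArrivalTime θ v) : Continuous θ :=
  continuous_iff_continuousAt.2 fun z => (hθ.deriv z).continuousAt

lemma continuous_entryLoad (hθ : IsArrivalTime θ v) (hf : IsProfile f m M) :
    Continuous (entryLoad u θ f) := by
  have h1 := hθ.continuous
  have h2 := hf.continuous_prim
  unfold entryLoad
  fun_prop

lemma entryLoad_pos (hθ : IsArrivalTime θ v) (hf : IsProfile f m M) (hu : 0 < u) {z : ℝ}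
    (hz : z ∈ Icc (-1 : ℝ) 0) : 0 < entryLoad u θ f z := by
  rcases hz.2.eq_or_lt with rfl | h0
  · simpa [entryLoad, hθ.zero] using hf.prim_pos one_pos
  · refine add_pos_of_pos_of_nonneg (mul_pos hu ?_) (hf.prim_nonneg (by linarith [hz.1]))
    rw [← hθ.zero]; exact hθ.mono (by linarith)

lemma hasDerivWithinAt_entry (hl : IsSpeed lam K) (hθ : IsArrivalTime θ v) (hf : IsProfile f m M)
    (hu : 0 < u) {z : ℝ} (hz : z ∈ Icc (-1 : ℝ) 0) {s : Set ℝ}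
    (h : HasDerivWithinAt (fun z => prim f (1 + z)) (f (1 + z)) s z) :
    HasDerivWithinAt (fun z => u / lam (entryLoad u θ f z)) (entryDeriv lam u θ v f z) s z := by
  have hq : HasDerivWithinAt (entryLoad u θ f) (entryLoadDeriv u v f z) s z := by
    have h1 : HasDerivAt (fun z => u * θ (-z)) (-(u * v (-z))) z := by
      have := ((hθ.deriv (-z)).comp z (hasDerivAt_neg z)).const_mul u
      exact this.congr_deriv (by ring)
    exact h1.hasDerivWithinAt.add h
  have hp := hθ.entryLoad_pos hf hu hz
  have h2 := (hl.hasDerivAt hp).comp_hasDerivWithinAt z hq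
  have h3 := (hasDerivWithinAt_const z s u).div h2 (hl.pos _ hp.le).ne'
  exact h3.congr_deriv (by simp [entryDeriv])

lemma hasDerivAt_entry (hl : IsSpeed lam K) (hθ : IsArrivalTime θ v) (hf : IsProfile f m M)
    (hu : 0 < u) {z : ℝ} (hz : z ∈ Icc (-1 : ℝ) 0) (h : ContinuousAt f (1 + z)) :
    HasDerivAt (fun z => u / lam (entryLoad u θ f z)) (entryDeriv lam u θ v f z) z := by
  rw [← hasDerivWithinAt_univ]
  refine hθ.hasDerivWithinAt_entry hl hf hu hz (HasDerivAt.hasDerivWithinAt ?_)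
  simpa using (hf.hasDerivAt_prim h).comp_const_add 1 z

lemma tendsto_lam_entryLoad (hl : IsSpeed lam K) (hθ : IsArrivalTime θ v) (hf : IsProfile f m M)
    (hu : 0 < u) {z : ℝ} (hz : z ∈ Icc (-1 : ℝ) 0) :
    Tendsto (fun z => lam (entryLoad u θ f z)) (𝓝 z) (𝓝 (lam (entryLoad u θ f z))) :=
  (hl.hasDerivAt (hθ.entryLoad_pos hf hu hz)).continuousAt.tendsto.comp
    ((hθ.continuous_entryLoad hf).tendsto z)

lemma tendsto_entryDeriv (hl : IsSpeed lam K) (hθ : IsArrivalTime θ v) (hf : IsProfile f m M)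
    (hu : 0 < u) {z l : ℝ} (hz : z ∈ Icc (-1 : ℝ) 0) {F : Filter ℝ} (hF : F ≤ 𝓝 z)
    (h : Tendsto (fun z => f (1 + z)) F (𝓝 l)) :
    Tendsto (entryDeriv lam u θ v f) F (𝓝 (-(u * (derivWithin lam (Ici 0) (entryLoad u θ f z) *
      (-(u * v (-z)) + l))) / lam (entryLoad u θ f z) ^ 2)) := by
  have hp := hθ.entryLoad_pos hf hu hz
  have h1 : Tendsto (fun z => derivWithin lam (Ici 0) (entryLoad u θ f z)) F
      (𝓝 (derivWithin lam (Ici 0) (entryLoad u θ f z))) :=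
    ((hl.continuousOn_derivWithin.continuousAt (Ici_mem_nhds hp)).tendsto.comp
      ((hθ.continuous_entryLoad hf).tendsto z)).mono_left hF
  have h2 : Tendsto (fun z => -(u * v (-z))) F (𝓝 (-(u * v (-z)))) := by
    have hv := hθ.cont
    exact ((by fun_prop : Continuous fun z => -(u * v (-z))).tendsto z).mono_left hF
  exact ((h1.mul (h2.add h)).const_mul u).neg.div
    (((hθ.tendsto_lam_entryLoad hl hf hu hz).mono_left hF).pow 2)
    (pow_ne_zero 2 (hl.pos _ hp.le).ne')

lemma tendsto_one_add_nhdsGT (z : ℝ) : Tendsto (fun z : ℝ => 1 + z) (𝓝[>] z) (𝓝[>] (1 + z)) := by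
  have := tendsto_sub_const_nhdsGT z (-1)
  simpa [sub_neg_eq_add, add_comm] using this

lemma rightReg_charProfile (hl : IsSpeed lam K) (hθ : IsArrivalTime θ v) (hf : IsProfile f m M)
    (hu : 0 < u) {z : ℝ} (hz : z ∈ Ico (-1 : ℝ) 1) : RightReg (charProfile lam u θ f) z := by
  have hR := (isPC1_iff.1 hf.pc1).2.1
  rcases lt_or_ge z 0 with h0 | h0
  · have hz' : z ∈ Icc (-1 : ℝ) 0 := ⟨hz.1, h0.le⟩
    obtain ⟨⟨l, hlim⟩, -, hd⟩ := hR (1 + z) ⟨by linarith [hz.1], by linarith⟩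
    have ht := tendsto_one_add_nhdsGT z
    have hreg : RightReg (fun z => u / lam (entryLoad u θ f z)) z := by
      refine RightReg.of_hasDerivAt (g := entryDeriv lam u θ v f)
        ((tendsto_const_nhds.div (hθ.tendsto_lam_entryLoad hl hf hu hz')
          (hl.pos _ (hθ.entryLoad_pos hf hu hz').le).ne').mono_left nhdsWithin_le_nhds)
        (hθ.tendsto_entryDeriv hl hf hu hz' nhdsWithin_le_nhds (hlim.comp ht)) ?_
      filter_upwards [ht.eventually hd, Ioo_mem_nhdsGT h0] with x hx hx'
      exact hθ.hasDerivAt_entry hl hf hu ⟨hz.1.trans hx'.1.le, hx'.2.le⟩ hx.continuousAt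
    refine hreg.congr ?_
    filter_upwards [Ioo_mem_nhdsGT h0] with x hx using charProfile_of_nonpos hx.2.le
  · refine (hR z ⟨h0, hz.2⟩).congr ?_
    filter_upwards [self_mem_nhdsWithin] with x hx using charProfile_of_pos (h0.trans_lt hx)

lemma differentiableWithinAt_charProfile (hl : IsSpeed lam K) (hθ : IsArrivalTime θ v)
    (hf : IsProfile f m M) (hu : 0 < u) {z : ℝ} (hz : z ∈ Ioc (-1 : ℝ) 1) :
    DifferentiableWithinAt ℝ (charProfile lam u θ f) (Iio z) z := by
  rcases le_or_gt z 0 with h0 | h0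
  · have h1 : HasDerivWithinAt (fun z => prim f (1 + z)) (f (1 + z)) (Iio z) z := by
      have h2 := hf.hasDerivWithinAt_prim (z := 1 + z) ⟨by linarith [hz.1], by linarith⟩
      have h3 := h2.comp z ((hasDerivAt_id z).const_add 1).hasDerivWithinAt
        (s := Iio z) (fun x hx => by simpa using hx)
      exact h3.congr_deriv (by simp)
    refine (hθ.hasDerivWithinAt_entry hl hf hu ⟨hz.1.le, h0⟩ h1).differentiableWithinAt.congr
      (fun x hx => charProfile_of_nonpos (le_of_lt hx |>.trans h0)) (charProfile_of_nonpos h0)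
  · refine ((isPC1_iff.1 hf.pc1).1 z ⟨h0, hz.2⟩).congr_of_eventuallyEq ?_ (charProfile_of_pos h0)
    filter_upwards [Ioo_mem_nhdsLT h0] with x hx using charProfile_of_pos hx.1

end IsArrivalTime

/-- The characteristic coordinates in `[-1,1]` that carry no singularity. -/
def regularCoords (Ξ : Finset ℝ) : Set ℝ := {z | z ∈ Icc (-1 : ℝ) 1 ∧ z ∉ Ξ ∧ z + 1 ∉ Ξ}

lemma IsArrivalTime.exists_deriv_charProfile (hl : IsSpeed lam K) (hθ : IsArrivalTime θ v)
    (hf : IsProfile f m M) (hu : 0 < u) {Ξ : Finset ℝ} (h0 : 0 ∈ Ξ) (hfΞ : IsC1Off f Ξ) :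
    ContinuousOn (charProfile lam u θ f) (regularCoords Ξ) ∧ ∃ G : ℝ → ℝ,
      ContinuousOn G (regularCoords Ξ) ∧ ∀ z ∈ regularCoords Ξ, z ∈ Ioo (-1 : ℝ) 1 →
        HasDerivAt (charProfile lam u θ f) (G z) z := by
  classical
  obtain ⟨hc, g, hg, hgd⟩ := hfΞ
  have hopen : IsOpen (Ξ : Set ℝ)ᶜ := Ξ.finite_toSet.isClosed.isOpen_compl
  have hne : ∀ z ∈ regularCoords Ξ, z ≠ 0 := fun z hz h => hz.2.1 (h ▸ h0)
  have hmem : ∀ z ∈ regularCoords Ξ, 0 < z → Icc (0 : ℝ) 1 \ (Ξ : Set ℝ) ∈ 𝓝[regularCoords Ξ] z := by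
    intro z hz hz0
    filter_upwards [self_mem_nhdsWithin, mem_nhdsWithin_of_mem_nhds (Ioi_mem_nhds hz0)] with x hx hx0
    exact ⟨⟨le_of_lt hx0, hx.1.2⟩, hx.2.1⟩
  have hneg : ∀ z ∈ regularCoords Ξ, z < 0 → z ∈ Icc (-1 : ℝ) 0 ∧ ContinuousAt f (1 + z) := by
    intro z hz hz0
    have hz1 : z ≠ -1 := fun h => hz.2.2 (by rw [h]; simpa using h0)
    have hz1 : -1 < z := lt_of_le_of_ne hz.1.1 hz1.symm
    refine ⟨⟨hz1.le, hz0.le⟩, hc.continuousAt ?_⟩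
    exact inter_mem (Icc_mem_nhds (by linarith) (by linarith))
      (hopen.mem_nhds (by rw [add_comm]; exact hz.2.2))
  have hder : ∀ z ∈ regularCoords Ξ, z < 0 →
      HasDerivAt (charProfile lam u θ f) (entryDeriv lam u θ v f z) z := by
    intro z hz hz0
    obtain ⟨h1, h2⟩ := hneg z hz hz0
    refine (hθ.hasDerivAt_entry hl hf hu h1 h2).congr_of_eventuallyEq ?_
    filter_upwards [Iio_mem_nhds hz0] with x hx using charProfile_of_nonpos (le_of_lt hx)
  refine ⟨fun z hz => ?_, fun z => if 0 < z then g z else entryDeriv lam u θ v f z,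
    fun z hz => ?_, fun z hz hz1 => ?_⟩
  · rcases (hne z hz).lt_or_gt with hz0 | hz0
    · exact (hder z hz hz0).continuousAt.continuousWithinAt
    · refine ((hc z ⟨⟨hz0.le, hz.1.2⟩, hz.2.1⟩).mono_of_mem_nhdsWithin
        (hmem z hz hz0)).congr_of_eventuallyEq ?_ (charProfile_of_pos hz0)
      filter_upwards [mem_nhdsWithin_of_mem_nhds (Ioi_mem_nhds hz0)] with x hx
      exact charProfile_of_pos hx
  · rcases (hne z hz).lt_or_gt with hz0 | hz0
    · obtain ⟨h1, h2⟩ := hneg z hz hz0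
      have h3 : ContinuousAt (entryDeriv lam u θ v f) z :=
        hθ.tendsto_entryDeriv hl hf hu h1 le_rfl
          (h2.tendsto.comp ((continuous_const.add continuous_id).tendsto z))
      refine (h3.congr ?_).continuousWithinAt
      filter_upwards [Iio_mem_nhds hz0] with x hx
      exact (if_neg (not_lt.2 (le_of_lt hx))).symm
    · refine ((hg z ⟨⟨hz0.le, hz.1.2⟩, hz.2.1⟩).mono_of_mem_nhdsWithin
        (hmem z hz hz0)).congr_of_eventuallyEq ?_ (if_pos hz0)
      filter_upwards [mem_nhdsWithin_of_mem_nhds (Ioi_mem_nhds hz0)] with x hx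
      exact if_pos hx
  · rcases (hne z hz).lt_or_gt with hz0 | hz0
    · simp only [if_neg hz0.not_gt]
      exact hder z hz hz0
    · simp only [if_pos hz0]
      refine (hgd z ⟨⟨hz0, hz1.2⟩, hz.2.1⟩).congr_of_eventuallyEq ?_
      filter_upwards [Ioi_mem_nhds hz0] with x hx using charProfile_of_pos hx

lemma IsArrivalTime.isPC1_charProfile (hl : IsSpeed lam K) (hθ : IsArrivalTime θ v)
    (hf : IsProfile f m M) (hu : 0 < u) {c : ℝ} (hc : c ∈ Icc (0 : ℝ) 1) :
    IsPC1 fun x => charProfile lam u θ f (x - c) := by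
  classical
  refine isPC1_iff.2 ⟨fun x hx => ?_, fun x hx => ?_, ?_⟩
  · have h1 := hθ.differentiableWithinAt_charProfile hl hf hu (z := x - c)
      ⟨by linarith [hx.1, hc.2], by linarith [hx.2, hc.1]⟩
    exact h1.comp x (differentiableAt_id.sub_const c).differentiableWithinAt
      (fun y hy => sub_lt_sub_right hy c)
  · exact (hθ.rightReg_charProfile hl hf hu (z := x - c)
      ⟨by linarith [hx.1, hc.2], by linarith [hx.2, hc.1]⟩).comp_sub_const
  · obtain ⟨Ξ, h0, -, hfΞ⟩ := hf.pc1.exists_isC1Off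
    obtain ⟨-, G, hG, hd⟩ := hθ.exists_deriv_charProfile hl hf hu h0 hfΞ
    let J := ((Ξ.image fun ξ => ξ + c) ∪ (Ξ.image fun ξ => ξ - 1 + c)).filter (· ∈ Ioo (0 : ℝ) 1)
    have hJ : ∀ x ∈ Ioo (0 : ℝ) 1 \ (J : Set ℝ), x - c ∈ regularCoords Ξ ∧ x - c ∈ Ioo (-1 : ℝ) 1 := by
      rintro x ⟨hx, hxJ⟩
      have hIoo : x - c ∈ Ioo (-1 : ℝ) 1 := ⟨by linarith [hx.1, hc.2], by linarith [hx.2, hc.1]⟩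
      refine ⟨⟨Ioo_subset_Icc_self hIoo, fun h => hxJ ?_, fun h => hxJ ?_⟩, hIoo⟩
      · refine Finset.mem_coe.2 (Finset.mem_filter.2 ⟨Finset.mem_union_left _ ?_, hx⟩)
        exact Finset.mem_image.2 ⟨_, h, by ring⟩
      · refine Finset.mem_coe.2 (Finset.mem_filter.2 ⟨Finset.mem_union_right _ ?_, hx⟩)
        exact Finset.mem_image.2 ⟨_, h, by ring⟩
    have hd' : ∀ x ∈ Ioo (0 : ℝ) 1 \ (J : Set ℝ),
        HasDerivAt (fun x => charProfile lam u θ f (x - c)) (G (x - c)) x := fun x hx =>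
      (hd _ (hJ x hx).1 (hJ x hx).2).comp_sub_const x c
    refine ⟨J, fun x hx => (Finset.mem_filter.1 (Finset.mem_coe.1 hx)).2,
      fun x hx => (hd' x hx).differentiableAt, ?_⟩
    refine (hG.comp (continuous_id.sub continuous_const).continuousOn
      fun x hx => (hJ x hx).1).congr fun x hx => (hd' x hx).deriv

/-- Existence for the plant, up to the time `1/λ(0)` before which no particle crosses the whole
system. -/
theorem exists_isIBVPSolution (hl : IsSpeed lam K) (hf : IsProfile f m M) (hu : 0 < u) :
    ∃ y, IsIBVPSolution lam (1 / lam 0) u f y := by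
  obtain ⟨w, a, hc, hw⟩ := exists_clock hl hf hu
  obtain ⟨θ, hθ1, hθ2, hθm, hθd⟩ := hc.exists_inverse hl
  have hθ : IsArrivalTime θ fun z => (lam (w (θ z)))⁻¹ :=
    { zero := by simpa [hc.start] using hθ2 0
      mono := hθm
      deriv := hθd
      cont := ((hc.continuous_speed hl).comp
        (continuous_iff_continuousAt.2 fun z => (hθd z).continuousAt)).inv₀
          fun z => (hc.speed_pos hl _).ne' }
  have hmem : ∀ t ∈ Icc 0 (1 / lam 0), a t ∈ Icc (0 : ℝ) 1 := fun t ht =>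
    ⟨hc.nonneg hl ht.1, hc.le_one hl ht⟩
  let y : ℝ → ℝ → ℝ := fun t x => charProfile lam u θ f (x - a t)
  have hr : Represents lam w a (1 / lam 0) u f y :=
    { shifted := fun t _ x hx => charProfile_of_pos (sub_pos.2 hx.1)
      inflow := fun t ht s hs => by
        have hs' : s ∈ Icc 0 (1 / lam 0) := ⟨hs.1, hs.2.trans ht.2⟩
        have has := hc.nonneg hl hs.1
        simp only [y]
        rw [charProfile_of_nonpos (by linarith), hw s hs', entryLoad]
        ring_nf
        rw [hθ2, mul_comm] }
  have hwl : ∀ t ∈ Icc 0 (1 / lam 0), workload y t = w t := fun t ht => by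
    rw [hr.workload_eq hl hc hf ht, hw t ht]
  have htr : ∀ t ∈ Icc 0 (1 / lam 0), travel lam y t = a t := fun t ht => by
    have h1 : travel lam y t = ∫ s in (0 : ℝ)..t, lam (w s) :=
      intervalIntegral.integral_congr fun s hs => by
        rw [uIcc_of_le ht.1] at hs
        simp only [hwl s ⟨hs.1, hs.2.trans ht.2⟩]
    rw [h1, intervalIntegral.integral_eq_sub_of_hasDerivAt (fun s _ => hc.deriv s)
      ((hc.continuous_speed hl).intervalIntegrable _ _), hc.start, sub_zero]
  refine ⟨y, fun t ht => hθ.isPC1_charProfile hl hf hu (hmem t ht), fun t ht => ?_,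
    hc.cont.continuousOn.congr hwl, fun Ξ h0 hΞ hfΞ => ?_, fun t ht => ?_, fun x hx => ?_⟩
  · refine ⟨min m (u / lam 0), lt_min hf.pos (div_pos hu hl.zero_pos), fun x hx => ?_⟩
    rcases lt_or_ge 0 (x - a t) with h | h
    · simp only [y, charProfile_of_pos h]; exact (min_le_left _ _).trans (hf.lower _)
    · simp only [y, charProfile_of_nonpos h]
      have hp := hθ.entryLoad_pos hf hu (z := x - a t) ⟨by linarith [hx.1, (hmem t ht).2], h⟩
      exact (min_le_right _ _).trans
        (div_le_div_of_nonneg_left hu.le (hl.pos _ hp.le) (hl.le_zero hp.le))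
  · obtain ⟨hΦ, G, hG, hd⟩ := hθ.exists_deriv_charProfile hl hf hu h0 hfΞ
    have hreg : ∀ p ∈ (Icc 0 (1 / lam 0) ×ˢ Icc (0 : ℝ) 1) \ singularSet lam y Ξ (1 / lam 0),
        p.2 - a p.1 ∈ regularCoords Ξ := by
      rintro ⟨t, x⟩ ⟨⟨ht, hx⟩, hs⟩
      simp only at ht hx ⊢
      have hat := hmem t ht
      refine ⟨⟨by linarith [hx.1, hat.2], by linarith [hx.2, hat.1]⟩, fun h => hs ?_, fun h => hs ?_⟩
      · refine ⟨ht, _, h, Or.inl ?_⟩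
        simp only [htr t ht]
        exact ⟨by linarith [hx.2], by ring⟩
      · refine ⟨ht, _, h, Or.inr ?_⟩
        simp only [htr t ht]
        exact ⟨by linarith [hx.1], by linarith [hx.2], by ring⟩
    have hac := hc.continuous
    have hcoord : Continuous fun p : ℝ × ℝ => p.2 - a p.1 := by fun_prop
    have hGc := hG.comp hcoord.continuousOn hreg
    refine ⟨hΦ.comp hcoord.continuousOn hreg, fun p => -(lam (w p.1) * G (p.2 - a p.1)),
      fun p => G (p.2 - a p.1), ?_, hGc, fun p hp => ?_, fun p hp => ?_⟩
    · exact (((hc.continuous_speed hl).comp continuous_fst).continuousOn.mul hGc).neg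
    · have hp1 := interior_subset hp
      have hp2 : p ∈ Ioo 0 (1 / lam 0) ×ˢ Ioo (0 : ℝ) 1 := by
        have := interior_mono sdiff_subset hp
        rwa [interior_prod_eq, interior_Icc, interior_Icc] at this
      have hat := hmem p.1 hp1.1.1
      have h1 := hd _ (hreg p hp1) ⟨by linarith [hp2.2.1, hat.2], by linarith [hp2.2.2, hat.1]⟩
      have h2 : HasFDerivAt (fun q : ℝ × ℝ => q.2 - a q.1)
          (ContinuousLinearMap.snd ℝ ℝ ℝ - lam (w p.1) • ContinuousLinearMap.fst ℝ ℝ ℝ) p :=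
        hasFDerivAt_snd.sub ((hc.deriv p.1).comp_hasFDerivAt p hasFDerivAt_fst)
      refine (h1.comp_hasFDerivAt p h2).congr_fderiv ?_
      rw [smul_sub, smul_smul, sub_eq_neg_add, ← neg_smul, mul_comm]
    · rw [hwl p.1 hp.1.1]; ring
  · have := hr.inflow t ht t ⟨ht.1, le_rfl⟩
    rw [sub_self] at this
    rw [this, hwl t ht, div_mul_cancel₀ _ (hc.speed_pos hl t).ne']
  · simp only [y, hc.start, sub_zero, charProfile_of_pos hx.1]

end Existence

/-! ### The weighted logarithmic norm -/

/-- The functional `sup_{0<x≤1} |ln (f(x)/ρs)| e^{-σx}` of the trigger rule. It plays the part of a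
Lyapunov functional. -/
noncomputable def weightedSup (ρs σ : ℝ) (f : ℝ → ℝ) : ℝ :=
  sSup ((fun x => |Real.log (f x / ρs)| * Real.exp (-σ * x)) '' Ioc (0 : ℝ) 1)

section Weighted

variable {ρs σ : ℝ} {f : ℝ → ℝ}

lemma abs_log_div_le {m M r : ℝ} (hρs : 0 < ρs) (hm : 0 < m) (h1 : m ≤ r) (h2 : r ≤ M) :
    |Real.log (r / ρs)| ≤ |Real.log (m / ρs)| + |Real.log (M / ρs)| := by
  have hr := hm.trans_le h1
  have h3 := Real.log_le_log (div_pos hm hρs) (div_le_div_of_nonneg_right h1 hρs.le)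
  have h4 := Real.log_le_log (div_pos hr hρs) (div_le_div_of_nonneg_right h2 hρs.le)
  rw [abs_le]
  constructor
  · linarith [neg_abs_le (Real.log (m / ρs)), abs_nonneg (Real.log (M / ρs))]
  · linarith [le_abs_self (Real.log (M / ρs)), abs_nonneg (Real.log (m / ρs))]

lemma IsPC1.exists_abs_log_le (hf : IsPC1 f) (hp : HasPosInf f (Ioc 0 1)) (hρs : 0 < ρs) :
    ∃ B, ∀ x ∈ Ioc (0 : ℝ) 1, |Real.log (f x / ρs)| ≤ B := by
  obtain ⟨m, hm, hmf⟩ := hp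
  obtain ⟨M, hM⟩ := hf.exists_upper_bound
  exact ⟨_, fun x hx => abs_log_div_le hρs hm (hmf x hx) (hM x hx)⟩

lemma exp_neg_mul_le_one (hσ : 0 < σ) {x : ℝ} (hx : 0 ≤ x) : Real.exp (-σ * x) ≤ 1 :=
  Real.exp_le_one_iff.2 (by nlinarith)

lemma weighted_le_weightedSup (hf : IsPC1 f) (hp : HasPosInf f (Ioc 0 1)) (hρs : 0 < ρs)
    (hσ : 0 < σ) {x : ℝ} (hx : x ∈ Ioc (0 : ℝ) 1) :
    |Real.log (f x / ρs)| * Real.exp (-σ * x) ≤ weightedSup ρs σ f := by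
  obtain ⟨B, hB⟩ := hf.exists_abs_log_le hp hρs
  refine le_csSup ⟨B, ?_⟩ (mem_image_of_mem _ hx)
  rintro _ ⟨z, hz, rfl⟩
  exact (mul_le_of_le_one_right (abs_nonneg _) (exp_neg_mul_le_one hσ hz.1.le)).trans (hB z hz)

lemma weightedSup_le {B : ℝ}
    (h : ∀ x ∈ Ioc (0 : ℝ) 1, |Real.log (f x / ρs)| * Real.exp (-σ * x) ≤ B) :
    weightedSup ρs σ f ≤ B :=
  csSup_le ((nonempty_Ioc.2 one_pos).image _) (by rintro _ ⟨x, hx, rfl⟩; exact h x hx)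

lemma weightedSup_nonneg : 0 ≤ weightedSup ρs σ f :=
  Real.sSup_nonneg (by rintro _ ⟨x, -, rfl⟩; positivity)

lemma weightedSup_congr {g : ℝ → ℝ} (h : EqOn g f (Ioc 0 1)) :
    weightedSup ρs σ g = weightedSup ρs σ f := by
  unfold weightedSup
  congr 1
  exact image_congr fun x hx => by rw [h hx]

lemma weightedSup_le_logSup (hf : IsPC1 f) (hp : HasPosInf f (Ioc 0 1)) (hρs : 0 < ρs)
    (hσ : 0 < σ) : weightedSup ρs σ f ≤ logSup ρs (Ioc 0 1) f := by
  obtain ⟨B, hB⟩ := hf.exists_abs_log_le hp hρs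
  refine weightedSup_le fun x hx =>
    (mul_le_of_le_one_right (abs_nonneg _) (exp_neg_mul_le_one hσ hx.1.le)).trans ?_
  exact le_csSup ⟨B, by rintro _ ⟨z, hz, rfl⟩; exact hB z hz⟩
    (mem_image_of_mem (fun x => |Real.log (f x / ρs)|) hx)

/-- Removing the weight costs a factor `e^σ`. -/
lemma le_exp_mul_of_weighted_le {r B x : ℝ} (hσ : 0 < σ) (hr : 0 ≤ r) (hx : x ≤ 1)
    (h : r * Real.exp (-σ * x) ≤ B) : r ≤ Real.exp σ * B := by
  have h1 : Real.exp σ * Real.exp (-σ * x) = Real.exp (σ * (1 - x)) := by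
    rw [← Real.exp_add]; ring_nf
  have h2 : 1 ≤ Real.exp (σ * (1 - x)) := Real.one_le_exp (mul_nonneg hσ.le (by linarith))
  calc r ≤ r * Real.exp (σ * (1 - x)) := le_mul_of_one_le_right hr h2
    _ = Real.exp σ * (r * Real.exp (-σ * x)) := by rw [← h1]; ring
    _ ≤ _ := mul_le_mul_of_nonneg_left h (Real.exp_pos _).le

lemma abs_log_le_exp_mul (hf : IsPC1 f) (hp : HasPosInf f (Ioc 0 1)) (hρs : 0 < ρs)
    (hσ : 0 < σ) {x : ℝ} (hx : x ∈ Ioc (0 : ℝ) 1) :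
    |Real.log (f x / ρs)| ≤ Real.exp σ * weightedSup ρs σ f :=
  le_exp_mul_of_weighted_le hσ (abs_nonneg _) hx.2 (weighted_le_weightedSup hf hp hρs hσ hx)

lemma le_mul_exp_of_abs_log_le {r B : ℝ} (hρs : 0 < ρs) (hr : 0 < r)
    (h : |Real.log (r / ρs)| ≤ B) : r ≤ ρs * Real.exp B := by
  have h1 := Real.exp_le_exp.2 ((le_abs_self _).trans h)
  rw [Real.exp_log (div_pos hr hρs), div_le_iff₀ hρs] at h1
  linarith

lemma abs_sub_le_of_abs_log_le {r B : ℝ} (hρs : 0 < ρs) (hr : 0 < r)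
    (h : |Real.log (r / ρs)| ≤ B) : |r - ρs| ≤ ρs * (B * Real.exp B) := by
  set L := Real.log (r / ρs) with hL
  have hrL : r = ρs * Real.exp L := by
    rw [hL, Real.exp_log (div_pos hr hρs)]; field_simp
  have hB : 0 ≤ B := (abs_nonneg _).trans h
  have h1 : |Real.exp L - 1| ≤ B * Real.exp B := by
    have hlow := Real.add_one_le_exp L
    have h2 := Real.add_one_le_exp (-L)
    have h3 : 1 - L ≤ Real.exp (-L) := by linarith
    have hE : Real.exp L * Real.exp (-L) = 1 := by rw [← Real.exp_add]; simp
    have h4 : Real.exp L - 1 ≤ L * Real.exp L := by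
      nlinarith [mul_le_mul_of_nonneg_left h3 (Real.exp_pos L).le]
    have h5 : L * Real.exp L ≤ B * Real.exp B :=
      mul_le_mul ((le_abs_self _).trans h) (Real.exp_le_exp.2 ((le_abs_self _).trans h))
        (Real.exp_pos _).le hB
    have h6 : B ≤ B * Real.exp B := le_mul_of_one_le_right hB (Real.one_le_exp hB)
    rw [abs_le]
    constructor
    · linarith [neg_abs_le L]
    · linarith
  calc |r - ρs| = ρs * |Real.exp L - 1| := by
        rw [hrL, ← mul_sub_one, abs_mul, abs_of_pos hρs]
    _ ≤ _ := mul_le_mul_of_nonneg_left h1 hρs.le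

lemma abs_log_sub_log_le {x y c : ℝ} (hc : 0 < c) (hx : c ≤ x) (hy : c ≤ y) :
    |Real.log x - Real.log y| ≤ |x - y| / c := by
  have key : ∀ {x y : ℝ}, c ≤ x → c ≤ y → Real.log x - Real.log y ≤ |x - y| / c := by
    intro x y hx hy
    have hx0 := hc.trans_le hx
    have hy0 := hc.trans_le hy
    rw [← Real.log_div hx0.ne' hy0.ne']
    refine (Real.log_le_sub_one_of_pos (div_pos hx0 hy0)).trans ?_
    rw [div_sub_one hy0.ne']
    exact (div_le_div_of_nonneg_right (le_abs_self _) hy0.le).trans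
      (div_le_div_of_nonneg_left (abs_nonneg _) hc hy)
  rw [abs_le]
  constructor
  · have := key hy hx
    rw [abs_sub_comm] at this
    linarith
  · exact key hx hy

lemma IsPC1.prim_one_le (hf : IsPC1 f) (hp : HasPosInf f (Ioc 0 1)) {B : ℝ}
    (h : ∀ x ∈ Ioc (0 : ℝ) 1, f x ≤ B) : prim f 1 ≤ B := by
  obtain ⟨g, m, M, hg, hgp⟩ := hf.exists_isProfile hp
  have h1 : prim f 1 = prim g 1 :=
    intervalIntegral.integral_congr_Ioo_of_le zero_le_one fun x hx =>
      (hg (Ioo_subset_Ioc_self hx)).symm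
  have h2 : prim g 1 ≤ ∫ _ in (0 : ℝ)..1, B :=
    intervalIntegral.integral_mono_on_of_le_Ioo zero_le_one (hgp.intervalIntegrable 0 1)
      intervalIntegrable_const fun x hx => by
        rw [hg (Ioo_subset_Ioc_self hx)]; exact h x (Ioo_subset_Ioc_self hx)
  rw [h1]
  simpa using h2

end Weighted

/-! ### One sampling interval -/

section Step

variable {lam w a : ℝ → ℝ} {K ρs σ u m M : ℝ} {f : ℝ → ℝ} {y : ℝ → ℝ → ℝ}

lemma Represents.apply_zero (hr : Represents lam w a (1 / lam 0) u f y) {t : ℝ}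
    (ht : t ∈ Icc 0 (1 / lam 0)) : y t 0 = u / lam (w t) := by
  have := hr.inflow t ht t ⟨ht.1, le_rfl⟩
  rwa [sub_self] at this

/-- While the trigger inequality is not violated, the weighted norm decays at the rate `σ` with
respect to the travelled distance: both the old values and those entering at `x = 0` are carried
along characteristics on which the weight decreases at this rate. -/
lemma Represents.weighted_le (hr : Represents lam w a (1 / lam 0) u f y) (hl : IsSpeed lam K)
    (hc : IsClock lam w a) (hf : IsProfile f m M) (hρs : 0 < ρs) (hσ : 0 < σ) {s : ℝ}
    (hs : s ∈ Icc 0 (1 / lam 0))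
    (h : ∀ r ∈ Ico 0 s, |Real.log (y r 0 / ρs)| ≤ Real.exp (-σ * a r) * weightedSup ρs σ f)
    {x : ℝ} (hx : x ∈ Ioc (0 : ℝ) 1) :
    |Real.log (y s x / ρs)| * Real.exp (-σ * x) ≤ Real.exp (-σ * a s) * weightedSup ρs σ f := by
  have has := hc.nonneg hl hs.1
  rcases lt_or_ge (a s) x with hxa | hxa
  · rw [hr.shifted s hs x ⟨hxa, hx.2⟩]
    have h1 := weighted_le_weightedSup (ρs := ρs) (σ := σ) hf.pc1 ⟨m, hf.pos, fun x _ => hf.lower x⟩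
      hρs hσ (x := x - a s) ⟨by linarith, by linarith [hx.2]⟩
    calc |Real.log (f (x - a s) / ρs)| * Real.exp (-σ * x)
        = Real.exp (-σ * a s) * (|Real.log (f (x - a s) / ρs)| * Real.exp (-σ * (x - a s))) := by
          rw [mul_left_comm, ← Real.exp_add]; ring_nf
      _ ≤ _ := mul_le_mul_of_nonneg_left h1 (Real.exp_pos _).le
  · obtain ⟨r, hr', rfl⟩ := hc.exists_foot hl ⟨hx.1.le, hxa⟩
    have hrs : r < s := (hc.strictMono hl).lt_iff_lt.1 (sub_pos.1 hx.1)
    rw [hr.inflow s hs r hr', ← hr.apply_zero ⟨hr'.1, hr'.2.trans hs.2⟩]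
    calc |Real.log (y r 0 / ρs)| * Real.exp (-σ * (a s - a r))
        ≤ Real.exp (-σ * a r) * weightedSup ρs σ f * Real.exp (-σ * (a s - a r)) :=
          mul_le_mul_of_nonneg_right (h r ⟨hr'.1, hrs⟩) (Real.exp_pos _).le
      _ = _ := by rw [mul_right_comm, ← Real.exp_add]; ring_nf

/-- For data of weighted norm `V ≤ S`, half the rate (relative to `V`) at which the work load can
leave its initial value, see `abs_load_sub_le`. The factor `e^σ e^{e^σ S}` comes from
`|f - ρs| ≤ ρs L e^L` with `L = e^σ V`, a bound for the unweighted norm. -/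
noncomputable def driftConst (lam : ℝ → ℝ) (ρs σ S : ℝ) : ℝ :=
  lam 0 * (ρs * (Real.exp σ * Real.exp (Real.exp σ * S)))

/-- Bounds the work load on an interval of length `1/λ(0)`, for data of weighted norm at
most `S`. -/
noncomputable def loadBound (lam : ℝ → ℝ) (ρs σ S : ℝ) : ℝ :=
  ρs * Real.exp (Real.exp σ * S) + 2 * driftConst lam ρs σ S * S * (1 / lam 0)

/-- The guaranteed time between events, for data of weighted norm at most `S`. The three members
of the minimum ensure that `a ≤ 1`, that the Lipschitz feedback of `W` on itself can be absorbed,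
and that `|ln λ(W(0)) - ln λ(W(s))| ≤ e^{-σ} V`. -/
noncomputable def dwellTime (lam : ℝ → ℝ) (K ρs σ S : ℝ) : ℝ :=
  min (1 / lam 0) (min (1 / (2 * ρs * K))
    (lam (loadBound lam ρs σ S) * Real.exp (-σ) / (2 * K * driftConst lam ρs σ S)))

lemma driftConst_pos (hl : IsSpeed lam K) (hρs : 0 < ρs) (S : ℝ) : 0 < driftConst lam ρs σ S := by
  have := hl.zero_pos
  unfold driftConst
  positivity

lemma driftConst_mono (hl : IsSpeed lam K) (hρs : 0 < ρs) {S S' : ℝ} (h : S ≤ S') :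
    driftConst lam ρs σ S ≤ driftConst lam ρs σ S' := by
  have := hl.zero_pos
  unfold driftConst
  gcongr

lemma loadBound_pos (hl : IsSpeed lam K) (hρs : 0 < ρs) {S : ℝ} (hS : 0 ≤ S) :
    0 < loadBound lam ρs σ S := by
  have := hl.zero_pos
  have := driftConst_pos (σ := σ) hl hρs S
  unfold loadBound
  positivity

lemma dwellTime_pos (hl : IsSpeed lam K) (hK : 0 < K) (hρs : 0 < ρs) {S : ℝ} (hS : 0 ≤ S) :
    0 < dwellTime lam K ρs σ S := by
  have h1 := hl.zero_pos
  have h2 := driftConst_pos (σ := σ) hl hρs S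
  have h3 := hl.pos _ (loadBound_pos (σ := σ) hl hρs hS).le
  refine lt_min ?_ (lt_min ?_ ?_) <;> positivity

lemma antitoneOn_dwellTime (hl : IsSpeed lam K) (hK : 0 < K) (hρs : 0 < ρs) :
    AntitoneOn (dwellTime lam K ρs σ) (Ici 0) := by
  intro S hS S' hS' h
  have h0 := hl.zero_pos
  have hS0 : 0 ≤ S := hS
  have hd := driftConst_mono (σ := σ) hl hρs h
  have hdp := driftConst_pos (σ := σ) hl hρs S
  have hdp' := driftConst_pos (σ := σ) hl hρs S'
  have hload : loadBound lam ρs σ S ≤ loadBound lam ρs σ S' := by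
    unfold loadBound
    gcongr
  have hlam := hl.anti (loadBound_pos (σ := σ) hl hρs hS).le (loadBound_pos hl hρs hS').le hload
  have hp := hl.pos _ (loadBound_pos (σ := σ) hl hρs hS).le
  refine min_le_min le_rfl (min_le_min le_rfl ?_)
  exact div_le_div₀ (by positivity) (mul_le_mul_of_nonneg_right hlam (Real.exp_pos _).le)
    (by positivity) (by gcongr)

/-- Equilibrium inflow: with `u = ρs λ(W(0))` the mass balance reads
`W(s) - W(0) = ρs (λ(W(0)) s - a(s)) - ∫_{1-a(s)}^1 (f - ρs)`. The first term is small by the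
Lipschitz continuity of `λ`, the second one because `f` is close to `ρs`. -/
lemma abs_load_sub_le_of_forall (hl : IsSpeed lam K) (hc : IsClock lam w a)
    (hf : IsProfile f m M) (hρs : 0 < ρs) (hσ : 0 < σ) {S : ℝ} (hS : weightedSup ρs σ f ≤ S)
    (hw : ∀ t ∈ Icc 0 (1 / lam 0), w t = ρs * lam (w 0) * t + prim f (1 - a t))
    {s D : ℝ} (hs : s ∈ Icc 0 (1 / lam 0)) (hD : ∀ r ∈ Icc 0 s, |w r - w 0| ≤ D) :
    |w s - w 0| ≤ ρs * K * s * D + driftConst lam ρs σ S * weightedSup ρs σ f * s := by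
  set V := weightedSup ρs σ f with hV
  have hV0 : 0 ≤ V := weightedSup_nonneg
  have has := hc.nonneg hl hs.1
  have has1 := hc.le_one hl hs
  have h1 : |lam (w 0) * s - a s| ≤ K * D * s := by
    have hder : ∀ r ∈ Icc 0 s, HasDerivWithinAt (fun r => lam (w 0) * r - a r)
        (lam (w 0) - lam (w r)) (Icc 0 s) r := fun r _ => by
      have := ((hasDerivAt_id r).const_mul (lam (w 0))).sub (hc.deriv r)
      exact (this.congr_deriv (by ring)).hasDerivWithinAt
    have := (convex_Icc 0 s).norm_image_sub_le_of_norm_hasDerivWithin_le (C := K * D) hder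
      (fun r hr => by
        refine (hl.abs_sub_le (hc.pos 0).le (hc.pos r).le).trans ?_
        rw [abs_sub_comm]
        exact mul_le_mul_of_nonneg_left (hD r hr) hl.nonneg_const)
      (left_mem_Icc.2 hs.1) (right_mem_Icc.2 hs.1)
    simpa [hc.start, abs_of_nonneg hs.1] using this
  have h2 : |prim f (1 - a s) - prim f 1 + ρs * a s| ≤
      ρs * (Real.exp σ * V * Real.exp (Real.exp σ * V)) * a s := by
    have h3 : prim f (1 - a s) - prim f 1 + ρs * a s = -∫ x in (1 - a s)..1, (f x - ρs) := by
      rw [intervalIntegral.integral_sub (hf.intervalIntegrable _ _) intervalIntegrable_const,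
        ← hf.prim_sub, intervalIntegral.integral_const, smul_eq_mul]
      ring
    have h4 := intervalIntegral.norm_integral_le_of_norm_le_const (f := fun x => f x - ρs)
      (C := ρs * (Real.exp σ * V * Real.exp (Real.exp σ * V))) (a := 1 - a s) (b := 1)
      fun x hx => by
        rw [uIoc_of_le (by linarith)] at hx
        exact abs_sub_le_of_abs_log_le hρs (hf.pos' x) (abs_log_le_exp_mul hf.pc1
          ⟨m, hf.pos, fun x _ => hf.lower x⟩ hρs hσ ⟨by linarith [hx.1], hx.2⟩)
    rw [h3, abs_neg]
    simpa [abs_of_nonneg has] using h4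
  have hw0 : w 0 = prim f 1 := by
    have := hw 0 ⟨le_rfl, hs.1.trans hs.2⟩
    simpa [hc.start] using this
  have h5 : w s - w 0 = ρs * (lam (w 0) * s - a s) + (prim f (1 - a s) - prim f 1 + ρs * a s) := by
    nth_rw 1 [hw s hs]
    rw [← hw0]
    ring
  have h6 : ρs * (Real.exp σ * V * Real.exp (Real.exp σ * V)) * a s ≤
      driftConst lam ρs σ S * V * s := by
    have h7 := hc.le_mul hl hs.1
    have h8 : Real.exp (Real.exp σ * V) ≤ Real.exp (Real.exp σ * S) :=
      Real.exp_le_exp.2 (mul_le_mul_of_nonneg_left hS (Real.exp_pos _).le)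
    calc ρs * (Real.exp σ * V * Real.exp (Real.exp σ * V)) * a s
        ≤ ρs * (Real.exp σ * V * Real.exp (Real.exp σ * S)) * (lam 0 * s) := by gcongr
      _ = _ := by rw [driftConst]; ring
  rw [h5]
  refine (abs_add_le _ _).trans (add_le_add ?_ (h2.trans h6))
  rw [abs_mul, abs_of_pos hρs]
  calc ρs * |lam (w 0) * s - a s| ≤ ρs * (K * D * s) := mul_le_mul_of_nonneg_left h1 hρs.le
    _ = _ := by ring

/-- Absorbing the first term of the previous bound, at a point where `|W - W(0)|` is maximal. -/
lemma abs_load_sub_le (hl : IsSpeed lam K) (hK : 0 < K) (hc : IsClock lam w a)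
    (hf : IsProfile f m M) (hρs : 0 < ρs) (hσ : 0 < σ) {S : ℝ} (hS : weightedSup ρs σ f ≤ S)
    (hw : ∀ t ∈ Icc 0 (1 / lam 0), w t = ρs * lam (w 0) * t + prim f (1 - a t))
    {s : ℝ} (hs : s ∈ Icc 0 (1 / lam 0)) (hs' : s ≤ 1 / (2 * ρs * K)) :
    |w s - w 0| ≤ 2 * driftConst lam ρs σ S * weightedSup ρs σ f * s := by
  have hcont : ContinuousOn (fun r => |w r - w 0|) (Icc 0 s) :=
    ((hc.cont.sub continuous_const).abs).continuousOn
  obtain ⟨r, hr, hmax⟩ := isCompact_Icc.exists_isMaxOn ⟨s, right_mem_Icc.2 hs.1⟩ hcont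
  have hmax' : ∀ r' ∈ Icc 0 s, |w r' - w 0| ≤ |w r - w 0| := fun r' hr' => hmax hr'
  have h1 := abs_load_sub_le_of_forall hl hc hf hρs hσ hS hw (s := r) (D := |w r - w 0|)
    ⟨hr.1, hr.2.trans hs.2⟩ fun r' hr' => hmax' r' ⟨hr'.1, hr'.2.trans hr.2⟩
  have h2 : ρs * K * r ≤ 1 / 2 := by
    have : r ≤ 1 / (2 * ρs * K) := hr.2.trans hs'
    rw [le_div_iff₀ (by positivity)] at this
    linarith
  have h3 := mul_le_mul_of_nonneg_right h2 (abs_nonneg (w r - w 0))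
  have h4 : driftConst lam ρs σ S * weightedSup ρs σ f * r ≤
      driftConst lam ρs σ S * weightedSup ρs σ f * s :=
    mul_le_mul_of_nonneg_left hr.2
      (mul_nonneg (driftConst_pos hl hρs S).le weightedSup_nonneg)
  linarith [hmax' s (right_mem_Icc.2 hs.1)]

/-- No event occurs before the dwell time. -/
lemma abs_log_inflow_le (hl : IsSpeed lam K) (hK : 0 < K) (hc : IsClock lam w a)
    (hf : IsProfile f m M) (hρs : 0 < ρs) (hσ : 0 < σ) {S : ℝ} (hS : weightedSup ρs σ f ≤ S)
    (hw : ∀ t ∈ Icc 0 (1 / lam 0), w t = ρs * lam (w 0) * t + prim f (1 - a t))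
    {s : ℝ} (hs : s ∈ Icc 0 (dwellTime lam K ρs σ S)) :
    |Real.log (ρs * lam (w 0) / lam (w s) / ρs)| ≤ Real.exp (-σ * a s) * weightedSup ρs σ f := by
  set V := weightedSup ρs σ f with hV
  have hV0 : 0 ≤ V := weightedSup_nonneg
  have hS0 : 0 ≤ S := hV0.trans hS
  have hsh : s ∈ Icc 0 (1 / lam 0) := ⟨hs.1, hs.2.trans (min_le_left _ _)⟩
  have hdr := driftConst_pos (σ := σ) hl hρs S
  have h1 := abs_load_sub_le hl hK hc hf hρs hσ hS hw hsh
    (hs.2.trans ((min_le_right _ _).trans (min_le_left _ _)))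
  have hlb := loadBound_pos (σ := σ) hl hρs hS0
  have hc' := hl.pos _ hlb.le
  have hw0 : w 0 ≤ ρs * Real.exp (Real.exp σ * S) := by
    have := hw 0 ⟨le_rfl, hsh.1.trans hsh.2⟩
    rw [hc.start, mul_zero, zero_add, sub_zero] at this
    rw [this]
    refine hf.pc1.prim_one_le ⟨m, hf.pos, fun x _ => hf.lower x⟩ fun x hx => ?_
    refine le_mul_exp_of_abs_log_le hρs (hf.pos' x) ((abs_log_le_exp_mul hf.pc1
      ⟨m, hf.pos, fun x _ => hf.lower x⟩ hρs hσ hx).trans ?_)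
    exact mul_le_mul_of_nonneg_left hS (Real.exp_pos _).le
  have hlam0 := hl.zero_pos
  have h2 : 2 * driftConst lam ρs σ S * V * s ≤ 2 * driftConst lam ρs σ S * S * (1 / lam 0) := by
    have := hsh.2
    have := hsh.1
    gcongr
  have h3 : lam (loadBound lam ρs σ S) ≤ lam (w 0) :=
    hl.anti (hc.pos 0).le hlb.le (hw0.trans (by
      have : 0 ≤ 2 * driftConst lam ρs σ S * S * (1 / lam 0) := by positivity
      rw [loadBound]; linarith))
  have h4 : lam (loadBound lam ρs σ S) ≤ lam (w s) :=
    hl.anti (hc.pos s).le hlb.le (by rw [loadBound]; linarith [le_abs_self (w s - w 0)])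
  have h5 : ρs * lam (w 0) / lam (w s) / ρs = lam (w 0) / lam (w s) := by field_simp
  rw [h5, Real.log_div (hc.speed_pos hl 0).ne' (hc.speed_pos hl s).ne']
  have h6 := hl.abs_sub_le (hc.pos 0).le (hc.pos s).le
  rw [abs_sub_comm (w 0)] at h6
  have h7 : s ≤ lam (loadBound lam ρs σ S) * Real.exp (-σ) / (2 * K * driftConst lam ρs σ S) :=
    hs.2.trans ((min_le_right _ _).trans (min_le_right _ _))
  rw [le_div_iff₀ (by positivity)] at h7
  calc |Real.log (lam (w 0)) - Real.log (lam (w s))|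
      ≤ |lam (w 0) - lam (w s)| / lam (loadBound lam ρs σ S) := abs_log_sub_log_le hc' h3 h4
    _ ≤ (K * (2 * driftConst lam ρs σ S * V * s)) / lam (loadBound lam ρs σ S) :=
        div_le_div_of_nonneg_right (h6.trans (mul_le_mul_of_nonneg_left h1 hK.le)) hc'.le
    _ ≤ Real.exp (-σ) * V := by
        rw [div_le_iff₀ hc']
        nlinarith [mul_le_mul_of_nonneg_right h7 hV0]
    _ ≤ _ := by
        refine mul_le_mul_of_nonneg_right (Real.exp_le_exp.2 ?_) hV0
        nlinarith [hc.le_one hl hsh]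

/-- What is needed about the plant on one sampling interval. -/
lemma IsIBVPSolution.step_bounds (hl : IsSpeed lam K) (hK : 0 < K) (hf : IsPC1 f)
    (hp : HasPosInf f (Ioc 0 1)) (hρs : 0 < ρs) (hσ : 0 < σ)
    (hy : IsIBVPSolution lam (1 / lam 0) (ρs * lam (prim f 1)) f y) {S : ℝ}
    (hS : weightedSup ρs σ f ≤ S) :
    (∀ s ∈ Icc 0 (dwellTime lam K ρs σ S),
      |Real.log (y s 0 / ρs)| ≤ Real.exp (-σ * travel lam y s) * weightedSup ρs σ f) ∧
    (∀ s ∈ Icc 0 (1 / lam 0), 0 ≤ travel lam y s) ∧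
    (∀ s ∈ Icc 0 (1 / lam 0), (∀ r ∈ Ico 0 s,
        |Real.log (y r 0 / ρs)| ≤ Real.exp (-σ * travel lam y r) * weightedSup ρs σ f) →
      (∀ x ∈ Ioc (0 : ℝ) 1, |Real.log (y s x / ρs)| * Real.exp (-σ * x) ≤
        Real.exp (-σ * travel lam y s) * weightedSup ρs σ f) ∧
      lam (ρs * Real.exp (Real.exp σ * S)) * s ≤ travel lam y s) := by
  obtain ⟨g, m, M, hgf, hg⟩ := hf.exists_isProfile hp
  have hprim : prim g 1 = prim f 1 :=
    intervalIntegral.integral_congr_Ioo_of_le zero_le_one (hgf.mono Ioo_subset_Ioc_self)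
  have hh : 0 ≤ 1 / lam 0 := (one_div_pos.2 hl.zero_pos).le
  have hyg := hy.congr hgf
  rw [← weightedSup_congr hgf] at hS ⊢
  obtain ⟨w, a, hc, hw, ha⟩ := hyg.exists_isClock hl hh
  have hr := hyg.represents hl hg.pc1 hc hw ha
  have hweq : ∀ t ∈ Icc 0 (1 / lam 0), w t = ρs * lam (prim f 1) * t + prim g (1 - a t) :=
    fun t ht => by rw [hw ht, hr.workload_eq hl hc hg ht]
  have hw0 : w 0 = prim f 1 := by
    simpa [hc.start, hprim] using hweq 0 (left_mem_Icc.2 hh)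
  rw [← hw0] at hweq hr
  have hdecay : ∀ s ∈ Icc 0 (1 / lam 0), (∀ r ∈ Ico 0 s,
        |Real.log (y r 0 / ρs)| ≤ Real.exp (-σ * travel lam y r) * weightedSup ρs σ g) →
      ∀ x ∈ Ioc (0 : ℝ) 1, |Real.log (y s x / ρs)| * Real.exp (-σ * x) ≤
        Real.exp (-σ * travel lam y s) * weightedSup ρs σ g := fun s hs h x hx => by
    rw [← ha hs]
    refine hr.weighted_le hl hc hg hρs hσ hs (fun r hr' => ?_) hx
    rw [ha ⟨hr'.1, hr'.2.le.trans hs.2⟩]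
    exact h r hr'
  refine ⟨fun s hs => ?_, fun s hs => ?_, fun s hs h => ⟨hdecay s hs h, ?_⟩⟩
  · have hsh : s ∈ Icc 0 (1 / lam 0) := ⟨hs.1, hs.2.trans (min_le_left _ _)⟩
    rw [hr.apply_zero hsh, ← ha hsh]
    exact abs_log_inflow_le hl hK hc hg hρs hσ hS hweq hs
  · rw [← ha hs]; exact hc.nonneg hl hs.1
  · have h1 := hc.mul_sub_le (c := lam (ρs * Real.exp (Real.exp σ * S))) hs.1 fun r hr' => by
      have hrh : r ∈ Icc 0 (1 / lam 0) := ⟨hr'.1.le, hr'.2.le.trans hs.2⟩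
      refine hl.anti (hc.pos r).le (by positivity : 0 ≤ ρs * _) ?_
      rw [hw hrh]
      have hpos := (hy.pos r hrh).mono (Ioc_subset_Icc_self)
      refine (hy.profile r hrh).prim_one_le hpos fun x hx => ?_
      obtain ⟨m', hm', hm2⟩ := hpos
      refine le_mul_exp_of_abs_log_le hρs (hm'.trans_le (hm2 x hx)) ?_
      refine le_exp_mul_of_weighted_le hσ (abs_nonneg _) hx.2 ?_
      refine (hdecay r hrh (fun r' hr2 => h r' ⟨hr2.1, hr2.2.trans hr'.2⟩) x hx).trans
        (le_trans ?_ hS)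
      refine mul_le_of_le_one_left weightedSup_nonneg (exp_neg_mul_le_one hσ ?_)
      rw [← ha hrh]; exact hc.nonneg hl hrh.1
    rw [hc.start, sub_zero, sub_zero, ha hs] at h1
    exact h1

end Step

/-! ### The closed loop -/

section ClosedLoop

variable {lam : ℝ → ℝ} {K ρs σ : ℝ}

lemma travel_congr {y y' : ℝ → ℝ → ℝ} {h : ℝ}
    (hyy : ∀ s ∈ Icc 0 h, EqOn (y' s) (y s) (Icc 0 1)) {s : ℝ} (hs : s ∈ Icc 0 h) :
    travel lam y' s = travel lam y s :=
  intervalIntegral.integral_congr fun r hr => by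
    rw [uIcc_of_le hs.1] at hr
    simp only [workload_congr ((hyy r ⟨hr.1, hr.2.trans hs.2⟩).mono Ioc_subset_Icc_self)]

lemma triggerTime_congr {y y' : ℝ → ℝ → ℝ} {f f' : ℝ → ℝ} {ti : ℝ}
    (hf : EqOn f' f (Ioc 0 1))
    (hyy : ∀ s ∈ Icc 0 (1 / lam 0), EqOn (y' s) (y s) (Icc 0 1)) :
    triggerTime lam ρs σ ti f' y' = triggerTime lam ρs σ ti f y := by
  unfold triggerTime
  have hV : sSup ((fun x => |Real.log (f' x / ρs)| * Real.exp (-σ * x)) '' Ioc (0 : ℝ) 1) =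
      sSup ((fun x => |Real.log (f x / ρs)| * Real.exp (-σ * x)) '' Ioc (0 : ℝ) 1) :=
    weightedSup_congr hf
  rw [hV]
  congr 2
  ext τ
  simp only [mem_ofPred_eq, and_congr_right_iff]
  intro h1 h2
  have hs : τ - ti ∈ Icc 0 (1 / lam 0) := ⟨by linarith, by linarith⟩
  rw [travel_congr hyy hs, hyy _ hs (left_mem_Icc.2 zero_le_one)]

variable {f : ℝ → ℝ} {y : ℝ → ℝ → ℝ}

lemma le_triggerTime (hl : IsSpeed lam K) (hK : 0 < K) (hf : IsPC1 f)
    (hp : HasPosInf f (Ioc 0 1)) (hρs : 0 < ρs) (hσ : 0 < σ)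
    (hy : IsIBVPSolution lam (1 / lam 0) (ρs * lam (prim f 1)) f y) {S : ℝ}
    (hS : weightedSup ρs σ f ≤ S) (ti : ℝ) :
    ((ti + dwellTime lam K ρs σ S : ℝ) : EReal) ≤ triggerTime lam ρs σ ti f y := by
  refine le_sInf ?_
  rintro _ ⟨τ, ⟨h1, h2, h3⟩, rfl⟩
  refine EReal.coe_le_coe_iff.2 (le_of_not_gt fun h4 => h3.not_ge ?_)
  exact (hy.step_bounds hl hK hf hp hρs hσ hS).1 _ ⟨by linarith, by linarith⟩

/-- The trigger inequality holds up to the next event. -/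
lemma abs_log_le_of_lt_triggerTime (hl : IsSpeed lam K) (hK : 0 < K) (hf : IsPC1 f)
    (hp : HasPosInf f (Ioc 0 1)) (hρs : 0 < ρs) (hσ : 0 < σ)
    (hy : IsIBVPSolution lam (1 / lam 0) (ρs * lam (prim f 1)) f y) {ti tn : ℝ}
    (htn : (tn : EReal) = min ((ti + 1 / lam 0 : ℝ) : EReal) (triggerTime lam ρs σ ti f y))
    {r : ℝ} (hr : r ∈ Ico 0 (tn - ti)) :
    |Real.log (y r 0 / ρs)| ≤ Real.exp (-σ * travel lam y r) * weightedSup ρs σ f := by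
  rcases hr.1.eq_or_lt with rfl | h0
  · exact (hy.step_bounds hl hK hf hp hρs hσ le_rfl).1 0
      (left_mem_Icc.2 (dwellTime_pos hl hK hρs weightedSup_nonneg).le)
  by_contra h
  have h1 : tn ≤ ti + 1 / lam 0 := EReal.coe_le_coe_iff.1 (htn ▸ min_le_left _ _)
  have h2 : triggerTime lam ρs σ ti f y ≤ ((ti + r : ℝ) : EReal) := by
    refine sInf_le ⟨ti + r, ⟨by linarith, by linarith [hr.2], ?_⟩, rfl⟩
    rw [add_sub_cancel_left]
    exact lt_of_not_ge h
  have h3 : tn ≤ ti + r := EReal.coe_le_coe_iff.1 (htn.le.trans ((min_le_right _ _).trans h2))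
  linarith [hr.2]

lemma add_dwellTime_le (hl : IsSpeed lam K) (hK : 0 < K) (hf : IsPC1 f)
    (hp : HasPosInf f (Ioc 0 1)) (hρs : 0 < ρs) (hσ : 0 < σ)
    (hy : IsIBVPSolution lam (1 / lam 0) (ρs * lam (prim f 1)) f y) {S : ℝ}
    (hS : weightedSup ρs σ f ≤ S) {ti tn : ℝ}
    (htn : (tn : EReal) = min ((ti + 1 / lam 0 : ℝ) : EReal) (triggerTime lam ρs σ ti f y)) :
    ti + dwellTime lam K ρs σ S ≤ tn := by
  refine EReal.coe_le_coe_iff.1 (htn ▸ le_min (EReal.coe_le_coe_iff.2 ?_)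
    (le_triggerTime hl hK hf hp hρs hσ hy hS ti))
  linarith [show dwellTime lam K ρs σ S ≤ 1 / lam 0 from min_le_left _ _]

lemma logSup_nonneg {S : Set ℝ} : 0 ≤ logSup ρs S f :=
  Real.sSup_nonneg (by rintro _ ⟨x, -, rfl⟩; positivity)

namespace IsClosedLoopSolution

variable {ρ₀ : ℝ → ℝ} {tev : ℕ → ℝ} {ρ : ℝ → ℝ → ℝ}

/-- The Lyapunov estimate at the event times. -/
lemma at_events (hρ : IsClosedLoopSolution lam ρs σ ρ₀ tev ρ) (hl : IsSpeed lam K) (hK : 0 < K)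
    (hρs : 0 < ρs) (hσ : 0 < σ) (hf : IsPC1 ρ₀) (hp : HasPosInf ρ₀ (Ioc 0 1)) (i : ℕ) :
    0 ≤ tev i ∧ IsPC1 (ρ (tev i)) ∧ HasPosInf (ρ (tev i)) (Ioc 0 1) ∧
      weightedSup ρs σ (ρ (tev i)) ≤
        Real.exp (-σ * (decayConst lam ρs σ ρ₀ * tev i)) * logSup ρs (Ioc 0 1) ρ₀ := by
  induction i with
  | zero =>
    have heq : EqOn (ρ (tev 0)) ρ₀ (Ioc 0 1) := by rw [hρ.start]; exact hρ.initial
    obtain ⟨m, hm, hm'⟩ := hp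
    refine ⟨hρ.start.ge, hf.congr heq, ⟨m, hm, fun x hx => (hm' x hx).trans (heq hx).ge⟩, ?_⟩
    rw [weightedSup_congr heq, hρ.start, mul_zero, mul_zero, Real.exp_zero, one_mul]
    exact weightedSup_le_logSup hf ⟨m, hm, hm'⟩ hρs hσ
  | succ i ih =>
    obtain ⟨ht, hfi, hpi, hV⟩ := ih
    obtain ⟨y, hy, htn, -, hnext⟩ := hρ.step i
    have hS0 : 0 ≤ logSup ρs (Ioc 0 1) ρ₀ := logSup_nonneg
    have hc0 : 0 < decayConst lam ρs σ ρ₀ := hl.pos _ (by positivity)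
    have hS : weightedSup ρs σ (ρ (tev i)) ≤ logSup ρs (Ioc 0 1) ρ₀ :=
      hV.trans (mul_le_of_le_one_left hS0 (exp_neg_mul_le_one hσ (by positivity)))
    have hlow := add_dwellTime_le hl hK hfi hpi hρs hσ hy hS htn
    have hT := dwellTime_pos (σ := σ) hl hK hρs hS0
    have hup : tev (i + 1) ≤ tev i + 1 / lam 0 :=
      EReal.coe_le_coe_iff.1 (htn ▸ min_le_left _ _)
    have hs : tev (i + 1) - tev i ∈ Icc 0 (1 / lam 0) := ⟨by linarith, by linarith⟩
    have heq : EqOn (ρ (tev (i + 1))) (y (tev (i + 1) - tev i)) (Ioc 0 1) := hnext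
    obtain ⟨m, hm, hm'⟩ := (hy.pos _ hs).mono Ioc_subset_Icc_self
    refine ⟨by linarith, (hy.profile _ hs).congr heq,
      ⟨m, hm, fun x hx => (hm' x hx).trans (heq hx).ge⟩, ?_⟩
    obtain ⟨-, -, h3⟩ := hy.step_bounds hl hK hfi hpi hρs hσ hS
    obtain ⟨h4, h5⟩ := h3 _ hs fun r hr =>
      abs_log_le_of_lt_triggerTime hl hK hfi hpi hρs hσ hy htn hr
    rw [weightedSup_congr heq]
    refine (weightedSup_le h4).trans ((mul_le_mul_of_nonneg_left hV (Real.exp_pos _).le).trans ?_)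
    rw [← mul_assoc, ← Real.exp_add]
    refine mul_le_mul_of_nonneg_right (Real.exp_le_exp.2 ?_) hS0
    have h6 := mul_le_mul_of_nonneg_left h5 hσ.le
    rw [decayConst] at *
    linarith

lemma weightedSup_le_logSup (hρ : IsClosedLoopSolution lam ρs σ ρ₀ tev ρ) (hl : IsSpeed lam K)
    (hK : 0 < K) (hρs : 0 < ρs) (hσ : 0 < σ) (hf : IsPC1 ρ₀) (hp : HasPosInf ρ₀ (Ioc 0 1))
    (i : ℕ) : weightedSup ρs σ (ρ (tev i)) ≤ logSup ρs (Ioc 0 1) ρ₀ := by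
  obtain ⟨ht, -, -, hV⟩ := hρ.at_events hl hK hρs hσ hf hp i
  have hc0 : 0 < decayConst lam ρs σ ρ₀ :=
    hl.pos _ (mul_nonneg hρs.le (Real.exp_pos _).le)
  exact hV.trans (mul_le_of_le_one_left logSup_nonneg (exp_neg_mul_le_one hσ (by positivity)))

lemma add_dwellTime_le (hρ : IsClosedLoopSolution lam ρs σ ρ₀ tev ρ) (hl : IsSpeed lam K)
    (hK : 0 < K) (hρs : 0 < ρs) (hσ : 0 < σ) (hf : IsPC1 ρ₀) (hp : HasPosInf ρ₀ (Ioc 0 1))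
    (i : ℕ) : tev i + dwellTime lam K ρs σ (logSup ρs (Ioc 0 1) ρ₀) ≤ tev (i + 1) := by
  obtain ⟨-, hfi, hpi, -⟩ := hρ.at_events hl hK hρs hσ hf hp i
  obtain ⟨y, hy, htn, -, -⟩ := hρ.step i
  exact Reentrant.add_dwellTime_le hl hK hfi hpi hρs hσ hy
    (hρ.weightedSup_le_logSup hl hK hρs hσ hf hp i) htn

lemma tendsto_atTop (hρ : IsClosedLoopSolution lam ρs σ ρ₀ tev ρ) (hl : IsSpeed lam K)
    (hK : 0 < K) (hρs : 0 < ρs) (hσ : 0 < σ) (hf : IsPC1 ρ₀) (hp : HasPosInf ρ₀ (Ioc 0 1)) :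
    Tendsto tev atTop atTop := by
  have hT := dwellTime_pos (σ := σ) hl hK hρs (logSup_nonneg (ρs := ρs) (f := ρ₀) (S := Ioc 0 1))
  refine tendsto_atTop_mono (fun n => ?_) (tendsto_natCast_atTop_atTop.atTop_mul_const hT)
  induction n with
  | zero => simp [hρ.start]
  | succ n ih =>
    have := hρ.add_dwellTime_le hl hK hρs hσ hf hp n
    push_cast
    linarith

/-- Every time belongs to a sampling interval. -/
lemma exists_mem_Ico (hρ : IsClosedLoopSolution lam ρs σ ρ₀ tev ρ) (hl : IsSpeed lam K)
    (hK : 0 < K) (hρs : 0 < ρs) (hσ : 0 < σ) (hf : IsPC1 ρ₀) (hp : HasPosInf ρ₀ (Ioc 0 1))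
    {t : ℝ} (ht : 0 ≤ t) : ∃ i, t ∈ Ico (tev i) (tev (i + 1)) := by
  classical
  have hex : ∃ n, t < tev n :=
    ((hρ.tendsto_atTop hl hK hρs hσ hf hp).eventually (eventually_gt_atTop t)).exists
  obtain ⟨i, hi⟩ : ∃ i, Nat.find hex = i + 1 := Nat.exists_eq_succ_of_ne_zero fun h => by
    have := Nat.find_spec hex
    rw [h, hρ.start] at this
    linarith
  refine ⟨i, le_of_not_gt (Nat.find_min hex (by omega)), ?_⟩
  rw [← hi]
  exact Nat.find_spec hex

/-- Regularity and decay between the event times. -/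
lemma at_time (hρ : IsClosedLoopSolution lam ρs σ ρ₀ tev ρ) (hl : IsSpeed lam K) (hK : 0 < K)
    (hρs : 0 < ρs) (hσ : 0 < σ) (hf : IsPC1 ρ₀) (hp : HasPosInf ρ₀ (Ioc 0 1)) {t : ℝ}
    (ht : 0 ≤ t) : IsPC1 (ρ t) ∧ HasPosInf (ρ t) (Icc 0 1) ∧
      ∀ x ∈ Icc (0 : ℝ) 1, |Real.log (ρ t x / ρs)| ≤
        Real.exp (-σ * (decayConst lam ρs σ ρ₀ * t - 1)) * logSup ρs (Ioc 0 1) ρ₀ := by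
  obtain ⟨i, hti, hti'⟩ := hρ.exists_mem_Ico hl hK hρs hσ hf hp ht
  obtain ⟨-, hfi, hpi, hV⟩ := hρ.at_events hl hK hρs hσ hf hp i
  obtain ⟨y, hy, htn, hbetween, -⟩ := hρ.step i
  have hup : tev (i + 1) ≤ tev i + 1 / lam 0 :=
    EReal.coe_le_coe_iff.1 (htn ▸ min_le_left _ _)
  have hs : t - tev i ∈ Ico 0 (tev (i + 1) - tev i) := ⟨by linarith, by linarith⟩
  have hs' : t - tev i ∈ Icc 0 (1 / lam 0) := ⟨hs.1, by linarith⟩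
  have heq : EqOn (ρ t) (y (t - tev i)) (Icc 0 1) := fun x hx => by
    have := hbetween _ hs x hx
    rwa [add_sub_cancel] at this
  obtain ⟨m, hm, hm'⟩ := hy.pos _ hs'
  refine ⟨(hy.profile _ hs').congr (heq.mono Ioc_subset_Icc_self),
    ⟨m, hm, fun x hx => (hm' x hx).trans (heq hx).ge⟩, fun x hx => ?_⟩
  rw [heq hx]
  have htrig : ∀ r ∈ Ico 0 (tev (i + 1) - tev i), _ := fun r hr =>
    abs_log_le_of_lt_triggerTime hl hK hfi hpi hρs hσ hy htn hr
  obtain ⟨-, -, h3⟩ := hy.step_bounds hl hK hfi hpi hρs hσ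
    (hρ.weightedSup_le_logSup hl hK hρs hσ hf hp i)
  obtain ⟨h4, h5⟩ := h3 _ hs' fun r hr => htrig r ⟨hr.1, hr.2.trans hs.2⟩
  have h6 : |Real.log (y (t - tev i) x / ρs)| * Real.exp (-σ * x) ≤
      Real.exp (-σ * travel lam y (t - tev i)) * weightedSup ρs σ (ρ (tev i)) := by
    rcases hx.1.eq_or_lt with rfl | hx0
    · rw [mul_zero, Real.exp_zero, mul_one]; exact htrig _ hs
    · exact h4 x ⟨hx0, hx.2⟩
  have hS0 : 0 ≤ logSup ρs (Ioc 0 1) ρ₀ := logSup_nonneg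
  refine (le_exp_mul_of_weighted_le hσ (abs_nonneg _) hx.2 (h6.trans
    (mul_le_mul_of_nonneg_left hV (Real.exp_pos _).le))).trans ?_
  rw [← mul_assoc, ← mul_assoc, ← Real.exp_add, ← Real.exp_add]
  refine mul_le_mul_of_nonneg_right (Real.exp_le_exp.2 ?_) hS0
  have h7 := mul_le_mul_of_nonneg_left h5 hσ.le
  rw [decayConst] at *
  linarith

/-- Two solutions that agree at an event time agree up to and including the next one. -/
lemma step_unique (hρ : IsClosedLoopSolution lam ρs σ ρ₀ tev ρ) {tev' : ℕ → ℝ} {ρ' : ℝ → ℝ → ℝ}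
    (hρ' : IsClosedLoopSolution lam ρs σ ρ₀ tev' ρ') (hl : IsSpeed lam K) {i : ℕ}
    (hfi : IsPC1 (ρ (tev i))) (hpi : HasPosInf (ρ (tev i)) (Ioc 0 1)) (hlt : tev i ≤ tev (i + 1))
    (ht : tev' i = tev i) (heq : EqOn (ρ' (tev' i)) (ρ (tev i)) (Ioc 0 1)) :
    tev' (i + 1) = tev (i + 1) ∧ EqOn (ρ' (tev' (i + 1))) (ρ (tev (i + 1))) (Ioc 0 1) ∧
      ∀ t ∈ Ico (tev i) (tev (i + 1)), EqOn (ρ' t) (ρ t) (Icc 0 1) := by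
  obtain ⟨y, hy, htn, hbetween, hnext⟩ := hρ.step i
  obtain ⟨y', hy', htn', hbetween', hnext'⟩ := hρ'.step i
  obtain ⟨g, m, M, hg, hgp⟩ := hfi.exists_isProfile hpi
  have hy2 := hy'.congr (hg.trans heq.symm)
  rw [workload_congr heq] at hy2
  have hyy : ∀ s ∈ Icc 0 (1 / lam 0), EqOn (y' s) (y s) (Icc 0 1) := fun s hs =>
    hy2.eqOn hl hgp (hy.congr hg) hs
  have htt : tev' (i + 1) = tev (i + 1) := by
    rw [triggerTime_congr heq hyy, ht, ← htn] at htn'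
    exact EReal.coe_eq_coe_iff.1 htn'
  have hup : tev (i + 1) ≤ tev i + 1 / lam 0 :=
    EReal.coe_le_coe_iff.1 (htn ▸ min_le_left _ _)
  rw [ht, htt] at hbetween' hnext'
  rw [htt]
  refine ⟨rfl, fun x hx => ?_, fun t hts x hx => ?_⟩
  · rw [hnext' x hx, hnext x hx]
    exact hyy _ ⟨by linarith, by linarith⟩ (Ioc_subset_Icc_self hx)
  · have hs : t - tev i ∈ Ico 0 (tev (i + 1) - tev i) := ⟨by linarith [hts.1], by linarith [hts.2]⟩
    have h1 := hbetween' _ hs x hx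
    have h2 := hbetween _ hs x hx
    rw [add_sub_cancel] at h1 h2
    rw [h1, h2]
    exact hyy _ ⟨hs.1, by linarith [hs.2]⟩ hx

theorem unique (hρ : IsClosedLoopSolution lam ρs σ ρ₀ tev ρ) {tev' : ℕ → ℝ} {ρ' : ℝ → ℝ → ℝ}
    (hρ' : IsClosedLoopSolution lam ρs σ ρ₀ tev' ρ') (hl : IsSpeed lam K) (hK : 0 < K)
    (hρs : 0 < ρs) (hσ : 0 < σ) (hf : IsPC1 ρ₀) (hp : HasPosInf ρ₀ (Ioc 0 1)) :
    tev' = tev ∧ ∀ t : ℝ, 0 ≤ t → EqOn (ρ' t) (ρ t) (Icc 0 1) := by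
  have hT := dwellTime_pos (σ := σ) hl hK hρs (logSup_nonneg (ρs := ρs) (f := ρ₀) (S := Ioc 0 1))
  have hstep := fun i (h : tev' i = tev i ∧ EqOn (ρ' (tev' i)) (ρ (tev i)) (Ioc 0 1)) =>
    hρ.step_unique hρ' hl (hρ.at_events hl hK hρs hσ hf hp i).2.1
      (hρ.at_events hl hK hρs hσ hf hp i).2.2.1
      (by linarith [hρ.add_dwellTime_le hl hK hρs hσ hf hp i]) h.1 h.2
  have hind : ∀ i, tev' i = tev i ∧ EqOn (ρ' (tev' i)) (ρ (tev i)) (Ioc 0 1) := by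
    intro i
    induction i with
    | zero =>
      rw [hρ.start, hρ'.start]
      exact ⟨rfl, fun x hx => (hρ'.initial x hx).trans (hρ.initial x hx).symm⟩
    | succ i ih => exact ⟨(hstep i ih).1, (hstep i ih).2.1⟩
  refine ⟨funext fun i => (hind i).1, fun t ht => ?_⟩
  obtain ⟨i, hi⟩ := hρ.exists_mem_Ico hl hK hρs hσ hf hp ht
  exact (hstep i (hind i)).2.2 t hi

end IsClosedLoopSolution

/-- The closed loop is solved by concatenating solutions of the plant. -/
theorem exists_isClosedLoopSolution (hl : IsSpeed lam K) (hK : 0 < K) (hρs : 0 < ρs) (hσ : 0 < σ)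
    {ρ₀ : ℝ → ℝ} (hf : IsPC1 ρ₀) (hp : HasPosInf ρ₀ (Ioc 0 1)) :
    ∃ (tev : ℕ → ℝ) (ρ : ℝ → ℝ → ℝ), IsClosedLoopSolution lam ρs σ ρ₀ tev ρ := by
  classical
  have hplant : ∀ f, ∃ y, IsPC1 f → HasPosInf f (Ioc 0 1) →
      IsIBVPSolution lam (1 / lam 0) (ρs * lam (prim f 1)) f y := by
    intro f
    by_cases h : IsPC1 f ∧ HasPosInf f (Ioc 0 1)
    · obtain ⟨g, m, M, hg, hgp⟩ := h.1.exists_isProfile h.2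
      have hW : 0 < prim f 1 := workload_pos (y := fun _ => f) (t := 0) h.1 h.2
      obtain ⟨y, hy⟩ := exists_isIBVPSolution hl hgp (mul_pos hρs (hl.pos _ hW.le))
      exact ⟨y, fun _ _ => hy.congr hg.symm⟩
    · exact ⟨0, fun h1 h2 => absurd ⟨h1, h2⟩ h⟩
  choose Y hY using hplant
  let tnext : ℝ × (ℝ → ℝ) → ℝ := fun p =>
    (min ((p.1 + 1 / lam 0 : ℝ) : EReal) (triggerTime lam ρs σ p.1 p.2 (Y p.2))).toReal
  let state : ℕ → ℝ × (ℝ → ℝ) := fun n =>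
    (fun p => (tnext p, Y p.2 (tnext p - p.1)))^[n] (0, ρ₀)
  let tev : ℕ → ℝ := fun n => (state n).1
  let F : ℕ → ℝ → ℝ := fun n => (state n).2
  have hsucc : ∀ n, state (n + 1) = (tnext (state n), Y (F n) (tnext (state n) - tev n)) :=
    fun n => Function.iterate_succ_apply' _ _ _
  have htsucc : ∀ n, tev (n + 1) = tnext (state n) := fun n => by simp only [tev, hsucc]
  have hFsucc : ∀ n, F (n + 1) = Y (F n) (tev (n + 1) - tev n) := fun n => by
    rw [htsucc]; simp only [F, hsucc]
  have hstep : ∀ n, IsPC1 (F n) → HasPosInf (F n) (Ioc 0 1) →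
      ((tev (n + 1) : ℝ) : EReal) =
        min ((tev n + 1 / lam 0 : ℝ) : EReal) (triggerTime lam ρs σ (tev n) (F n) (Y (F n))) ∧
      tev n < tev (n + 1) ∧ tev (n + 1) ≤ tev n + 1 / lam 0 := by
    intro n h1 h2
    have hlow := le_triggerTime hl hK h1 h2 hρs hσ (hY _ h1 h2) le_rfl (tev n)
    have hcoe : ((tev (n + 1) : ℝ) : EReal) =
        min ((tev n + 1 / lam 0 : ℝ) : EReal) (triggerTime lam ρs σ (tev n) (F n) (Y (F n))) := by
      rw [htsucc]
      refine EReal.coe_toReal ?_ ?_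
      · exact ((min_le_left _ _).trans_lt (EReal.coe_lt_top _)).ne
      · exact (lt_min (EReal.bot_lt_coe _) ((EReal.bot_lt_coe _).trans_le hlow)).ne'
    refine ⟨hcoe, ?_, EReal.coe_le_coe_iff.1 (hcoe ▸ min_le_left _ _)⟩
    have := add_dwellTime_le hl hK h1 h2 hρs hσ (hY _ h1 h2) le_rfl hcoe
    linarith [dwellTime_pos (σ := σ) hl hK hρs (weightedSup_nonneg (ρs := ρs) (σ := σ) (f := F n))]
  have hinv : ∀ n, IsPC1 (F n) ∧ HasPosInf (F n) (Ioc 0 1) := by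
    intro n
    induction n with
    | zero => exact ⟨hf, hp⟩
    | succ n ih =>
      obtain ⟨-, h1, h2⟩ := hstep n ih.1 ih.2
      have hs : tev (n + 1) - tev n ∈ Icc 0 (1 / lam 0) := ⟨by linarith, by linarith⟩
      rw [hFsucc]
      exact ⟨(hY _ ih.1 ih.2).profile _ hs,
        ((hY _ ih.1 ih.2).pos _ hs).mono Ioc_subset_Icc_self⟩
  have hmono : StrictMono tev :=
    strictMono_nat_of_lt_succ fun n => (hstep n (hinv n).1 (hinv n).2).2.1
  let ρ : ℝ → ℝ → ℝ := fun t =>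
    if h : ∃ n, t ∈ Ico (tev n) (tev (n + 1)) then Y (F h.choose) (t - tev h.choose) else 0
  have hρ : ∀ n, ∀ t ∈ Ico (tev n) (tev (n + 1)), ρ t = Y (F n) (t - tev n) := by
    intro n t ht
    have hex : ∃ n, t ∈ Ico (tev n) (tev (n + 1)) := ⟨n, ht⟩
    have hn : hex.choose = n := by
      have hspec := hex.choose_spec
      have h1 := hmono.lt_iff_lt.1 (ht.1.trans_lt hspec.2)
      have h2 := hmono.lt_iff_lt.1 (hspec.1.trans_lt ht.2)
      omega
    simp only [ρ, dif_pos hex, hn]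
  have hρev : ∀ n, EqOn (ρ (tev n)) (F n) (Ioc 0 1) := fun n x hx => by
    rw [hρ n _ ⟨le_rfl, hmono n.lt_succ_self⟩, sub_self]
    exact (hY _ (hinv n).1 (hinv n).2).initial x hx
  refine ⟨tev, ρ, rfl, hρev 0, fun n => ⟨Y (F n), ?_, ?_, fun s hs x _ => ?_, fun x hx => ?_⟩⟩
  · have := (hY _ (hinv n).1 (hinv n).2).congr (hρev n)
    have hW : workload ρ (tev n) = prim (F n) 1 :=
      workload_congr (y' := fun _ => F n) (t' := 0) (hρev n)
    rwa [hW]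
  · rw [triggerTime_congr (hρev n) fun s _ => eqOn_refl _ _]
    exact (hstep n (hinv n).1 (hinv n).2).1
  · rw [hρ n _ ⟨by linarith [hs.1], by linarith [hs.2]⟩, add_sub_cancel_left]
  · rw [hρev (n + 1) hx, hFsucc]

end ClosedLoop

end Reentrant

theorem theorem2 (lam : ℝ → ℝ) (K ρs σ : ℝ)
    (hlam_C1 : ContDiffOn ℝ 1 lam (Set.Ici 0))
    (hlam_pos : ∀ s : ℝ, 0 ≤ s → 0 < lam s)
    (hlam_anti : AntitoneOn lam (Set.Ici 0))
    (hK : 0 < K)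
    (hlam_deriv : ∀ s : ℝ, 0 ≤ s → |derivWithin lam (Set.Ici 0) s| ≤ K)
    (hρs : 0 < ρs) (hσ : 0 < σ) :
    ∃ T : ℝ → ℝ, AntitoneOn T (Set.Ici 0) ∧ (∀ s : ℝ, 0 ≤ s → 0 < T s) ∧
      ∀ ρ₀ : ℝ → ℝ, Reentrant.IsPC1 ρ₀ → Reentrant.HasPosInf ρ₀ (Set.Ioc 0 1) →
        ∃ (tev : ℕ → ℝ) (ρ : ℝ → ℝ → ℝ),
          -- existence of the closed-loop solution
          Reentrant.IsClosedLoopSolution lam ρs σ ρ₀ tev ρ ∧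
          -- its uniqueness
          (∀ (tev' : ℕ → ℝ) (ρ' : ℝ → ℝ → ℝ),
            Reentrant.IsClosedLoopSolution lam ρs σ ρ₀ tev' ρ' →
              tev' = tev ∧ ∀ t : ℝ, 0 ≤ t → ∀ x ∈ Set.Icc (0 : ℝ) 1, ρ' t x = ρ t x) ∧
          -- it is defined for all times, with positive piecewise smooth profiles
          Filter.Tendsto tev Filter.atTop Filter.atTop ∧
          (∀ t : ℝ, 0 ≤ t →
            Reentrant.IsPC1 (ρ t) ∧ Reentrant.HasPosInf (ρ t) (Set.Icc 0 1)) ∧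
          -- the exponential estimate in the logarithmic norm
          (∀ t : ℝ, 0 ≤ t →
            BddAbove ((fun x => |Real.log (ρ t x / ρs)|) '' Set.Icc (0 : ℝ) 1) ∧
            Reentrant.logSup ρs (Set.Icc 0 1) (ρ t) ≤
              Real.exp (-σ * (Reentrant.decayConst lam ρs σ ρ₀ * t - 1)) *
                Reentrant.logSup ρs (Set.Ioc 0 1) ρ₀) ∧
          -- the lower bound on the inter-event times
          (∀ i : ℕ, tev i + T (Reentrant.logSup ρs (Set.Ioc 0 1) ρ₀) ≤ tev (i + 1)) := by
  have hl : Reentrant.IsSpeed lam K := ⟨hlam_C1, hlam_pos, hlam_anti, hlam_deriv⟩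
  refine ⟨Reentrant.dwellTime lam K ρs σ, Reentrant.antitoneOn_dwellTime hl hK hρs,
    fun s hs => Reentrant.dwellTime_pos hl hK hρs hs, fun ρ₀ hf hp => ?_⟩
  obtain ⟨tev, ρ, hρ⟩ := Reentrant.exists_isClosedLoopSolution hl hK hρs hσ hf hp
  refine ⟨tev, ρ, hρ, fun tev' ρ' hρ' => hρ.unique hρ' hl hK hρs hσ hf hp,
    hρ.tendsto_atTop hl hK hρs hσ hf hp, fun t ht => ?_, fun t ht => ?_,
    hρ.add_dwellTime_le hl hK hρs hσ hf hp⟩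
  · obtain ⟨h1, h2, -⟩ := hρ.at_time hl hK hρs hσ hf hp ht
    exact ⟨h1, h2⟩
  · obtain ⟨-, -, h3⟩ := hρ.at_time hl hK hρs hσ hf hp ht
    have h4 : ∀ r ∈ (fun x => |Real.log (ρ t x / ρs)|) '' Set.Icc (0 : ℝ) 1, r ≤
        Real.exp (-σ * (Reentrant.decayConst lam ρs σ ρ₀ * t - 1)) *
          Reentrant.logSup ρs (Set.Ioc 0 1) ρ₀ := by
      rintro _ ⟨x, hx, rfl⟩
      exact h3 x hx
    exact ⟨⟨_, h4⟩, csSup_le ((Set.nonempty_Icc.2 zero_le_one).image _) h4⟩
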